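/- Let $n\ge 3$ and let $\Omega\subset\mathbb R$ be an infinite compact set. A \emph{positive basis} of a finite-dimensional subspace $X$ of $C(\Omega)$ (the space of real continuous functions on $\Omega$ with the pointwise ordering) is a basis of $X$ consisting of functions that are nonnegative on $\Omega$, such that every $f\in X$ that is nonnegative on $\Omega$ is a linear combination of the basis elements with nonnegative coefficients. Let $d_n(\Omega)$ be the minimum of $\max_{1\le j\le n}\deg b_j$ over all real polynomials $b_1,\dots,b_n$ whose restrictions to $\Omega$ form a positive basis of some $n$-dimensional subspace of $C(\Omega)$. A \emph{hole} of $\Omega$ is a bounded connected component of $\mathbb R\setminus\Omega$; a family of holes is \emph{free} if the closures of its members are pairwise disjoint; $\lambda(\Omega)\in\{0,1,2,\dots\}\cup\{\infty\}$ is the maximal number of members of a free family of holes. Let $\dot\Omega$ be the set of limit points of $\Omega$. The points of $\Omega$ lying outside the convex hull of $\dot\Omega$ are called \emph{eccentric}; if there are only finitely many of them (as is the case when $\lambda(\Omega)<\infty$), let $\Theta_\ell,\Theta_r\in\{0,1\}$ be the parities of the number of eccentric points to the left, respectively to the right, of $\dot\Omega$. Then the minimum defining $d_n(\Omega)$ exists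 and $$ d_n(\Omega)=\begin{cases} n & \text{if } \lambda(\Omega)>\frac n2,\\ n & \text{if } \lambda(\Omega)=\left\lfloor\frac n2\right\rfloor \text{ and } n \text{ is even},\\ n+\Theta_\ell\Theta_r & \text{if } \lambda(\Omega)=\left\lfloor\frac n2\right\rfloor \text{ and } n \text{ is odd},\\ 2\,(n-1-\lambda(\Omega))+\Theta_\ell+\Theta_r & \text{if } 1\le\lambda(\Omega)\le\frac n2-1,\\ 2n-3 & \text{if } \lambda(\Omega)=0. \end{cases} $$ -/

import Mathlib

open Polynomial

/-- `b` is a positive basis of the subspace `X` of an ordered real vector space: it is a basis of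
`X` consisting of nonnegative elements, and every nonnegative element of `X` is a linear
combination of the basis elements with nonnegative coefficients. -/
structure IsPositiveBasis {E ι : Type*} [AddCommGroup E] [Module ℝ E] [PartialOrder E]
    [Fintype ι] (X : Submodule ℝ E) (b : ι → E) : Prop where
  linearIndependent : LinearIndependent ℝ b
  span_eq : Submodule.span ℝ (Set.range b) = X
  nonneg : ∀ j, 0 ≤ b j
  nonneg_coeff : ∀ f ∈ X, 0 ≤ f → ∃ c : ι → ℝ, (∀ j, 0 ≤ c j) ∧ f = ∑ j, c j • b j

/-- The set of all values `max_j deg b_j`, where `b_1, …, b_n` are polynomials whose restrictions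
to `Ω` form a positive basis of a subspace of `C(Ω)` (with the pointwise ordering). For positive
`n` and infinite `Ω` its least element is `d_n(Ω)`. -/
def positiveBasisMaxDegrees (Ω : Set ℝ) (n : ℕ) : Set ℕ :=
  {m | ∃ (X : Submodule ℝ C(Ω, ℝ)) (b : Fin n → ℝ[X]),
    IsPositiveBasis X (fun j => (b j).toContinuousMapOn Ω) ∧
    Finset.univ.sup (fun j => (b j).natDegree) = m}

/-- The holes of a closed set `Ω`, i.e. the bounded connected components `(α, β)` of its
complement, recorded as pairs of endpoints: `α < β` lie in `Ω` and `(α, β)` misses `Ω`. -/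
def holes (Ω : Set ℝ) : Set (ℝ × ℝ) :=
  {I | I.1 < I.2 ∧ I.1 ∈ Ω ∧ I.2 ∈ Ω ∧ Disjoint (Set.Ioo I.1 I.2) Ω}

/-- A free family of holes: a set of holes whose closures are pairwise disjoint. -/
def IsFreeFamily (Ω : Set ℝ) (L : Set (ℝ × ℝ)) : Prop :=
  L ⊆ holes Ω ∧
    L.Pairwise fun I J => Disjoint (closure (Set.Ioo I.1 I.2)) (closure (Set.Ioo J.1 J.2))

/-- `λ(Ω)`: the maximal number of members of a free family of holes (possibly `∞`). -/
noncomputable def freeHoleNumber (Ω : Set ℝ) : ℕ∞ :=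
  ⨆ L ∈ {L : Set (ℝ × ℝ) | IsFreeFamily Ω L}, L.encard

/-- The eccentric points of `Ω`: those outside the convex hull of the limit points of `Ω`. -/
def eccentricPoints (Ω : Set ℝ) : Set ℝ :=
  Ω \ convexHull ℝ (derivedSet Ω)

/-- `Θ_ℓ ∈ {0, 1}`: the parity of the number of eccentric points on the left-hand side. It is
meant for sets with finitely many of them. -/
noncomputable def leftParity (Ω : Set ℝ) : ℕ :=
  {x ∈ eccentricPoints Ω | ∀ y ∈ derivedSet Ω, x < y}.ncard % 2

/-- `Θ_r ∈ {0, 1}`: the parity of the number of eccentric points on the right-hand side. It is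
meant for sets with finitely many of them. -/
noncomputable def rightParity (Ω : Set ℝ) : ℕ :=
  {x ∈ eccentricPoints Ω | ∀ y ∈ derivedSet Ω, y < x}.ncard % 2

/-! Lower bound. If `b` is a positive basis, each `b j` has a node in `Ω` at which it vanishes to
smaller order than every other member (`IsPositiveBasis.exists_node`): otherwise compactness gives
`b j ≤ D * ∑ b i` on `Ω`, the sum over `i ≠ j`, and the difference is a nonnegative function with
coefficient `-1` at `b j`. So each member vanishes at the `n - 1` nodes of the others.

For a polynomial nonnegative on `Ω`, a zero in `Ω` costs two degrees, except that simple zeros can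
sit at the two ends of a hole or at an extremal point of `Ω`. Thus `2 |S| ≤ deg + 2 |F| + sl + sr`
for a free family `F` with endpoints in the zero set `S` and indicators `sl`, `sr` of extremal
points used (`exists_holeConfig`). The member of the basis may be chosen so that a prescribed point
is not among its `n - 1` zeros at nodes. For finite `λ ≥ 1` a well-chosen point forces `2 |F| + sl +
sr ≤ 2 λ - Θ_ℓ - Θ_r` (`exists_critical_point`); for `λ = 0` the left end serves. The bound `n`
comes from interpolation at the nodes (`le_sup_natDegree`).

The parities enter because the eccentric points on one side, with the nearest limit point, form a
block that no hole leaves. An even block is perfectly matched by holes only if its extremal point is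
used; an odd block has an optimal matching that avoids it.

Upper bound. Nonnegative polynomials of Lagrange type form a positive basis, since values at the
nodes read off the coefficients. They are products of `(X - α) * (X - β)` for holes `(α, β)`, linear
factors at free extremal points, and squares elsewhere (`NodeSystem`). -/

variable {Ω : Set ℝ}

/-! ### Free families as finite sets of holes -/

/-- A finite set of holes with pairwise disjoint closures, expressed through the endpoints. -/
def SeparatedHoles (Ω : Set ℝ) (F : Finset (ℝ × ℝ)) : Prop :=
  (∀ H ∈ F, H ∈ holes Ω) ∧ ∀ H ∈ F, ∀ J ∈ F, H ≠ J → H.2 < J.1 ∨ J.2 < H.1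

/-- No member of `F` has `x` as an endpoint. -/
def AvoidsPoint (F : Finset (ℝ × ℝ)) (x : ℝ) : Prop :=
  ∀ H ∈ F, H.1 ≠ x ∧ H.2 ≠ x

/-- `T` contains every point of `Ω` lying between two of its points. -/
def RelOrdConnected (Ω : Set ℝ) (T : Finset ℝ) : Prop :=
  ∀ s ∈ T, ∀ t ∈ T, ∀ x ∈ Ω, s ≤ x → x ≤ t → x ∈ T

theorem isFreeFamily_coe_iff {F : Finset (ℝ × ℝ)} :
    IsFreeFamily Ω (F : Set (ℝ × ℝ)) ↔ SeparatedHoles Ω F := by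
  have key : ∀ H ∈ holes Ω, ∀ J ∈ holes Ω,
      Disjoint (closure (Set.Ioo H.1 H.2)) (closure (Set.Ioo J.1 J.2)) ↔
        (H.2 < J.1 ∨ J.2 < H.1) := by
    intro H hH J hJ
    rw [closure_Ioo hH.1.ne, closure_Ioo hJ.1.ne, Set.disjoint_left]
    have h1 := hH.1
    have h2 := hJ.1
    constructor
    · intro h
      by_contra hc
      push Not at hc
      refine h (a := max H.1 J.1) ⟨le_max_left _ _, max_le h1.le hc.1⟩
        ⟨le_max_right _ _, max_le hc.2 h2.le⟩
    · rintro h x ⟨hx1, hx2⟩ ⟨hx3, hx4⟩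
      rcases h with h | h <;> linarith
  constructor
  · rintro ⟨h1, h2⟩
    exact ⟨fun H hH => h1 hH, fun H hH J hJ hne =>
      (key H (h1 hH) J (h1 hJ)).1 (h2 hH hJ hne)⟩
  · rintro ⟨h1, h2⟩
    exact ⟨fun H hH => h1 H hH, fun H hH J hJ hne =>
      (key H (h1 H hH) J (h1 J hJ)).2 (h2 H hH J hJ hne)⟩

theorem SeparatedHoles.card_le_freeHoleNumber {F : Finset (ℝ × ℝ)} (hF : SeparatedHoles Ω F) :
    (F.card : ℕ∞) ≤ freeHoleNumber Ω := by
  rw [← Set.encard_coe_eq_coe_finsetCard]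
  exact le_iSup₂_of_le (f := fun (L : Set (ℝ × ℝ)) (_ : L ∈ {L | IsFreeFamily Ω L}) => L.encard)
    (F : Set (ℝ × ℝ)) (isFreeFamily_coe_iff.2 hF) le_rfl

theorem exists_separatedHoles_of_le {k : ℕ} (hk : (k : ℕ∞) ≤ freeHoleNumber Ω) :
    ∃ F, SeparatedHoles Ω F ∧ F.card = k := by
  rcases k with _ | k
  · exact ⟨∅, ⟨by simp, by simp⟩, rfl⟩
  have h1 : (k : ℕ∞) < freeHoleNumber Ω := lt_of_lt_of_le (by exact_mod_cast Nat.lt_succ_self k) hk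
  unfold freeHoleNumber at h1
  simp only [lt_iSup_iff] at h1
  obtain ⟨L, hL, hkL⟩ := h1
  have h2 : ((k + 1 : ℕ) : ℕ∞) ≤ L.encard := by
    have := Order.add_one_le_of_lt hkL
    exact_mod_cast this
  obtain ⟨L', hL', hcard⟩ := Set.exists_subset_encard_eq h2
  have hfin : L'.Finite := Set.finite_of_encard_eq_coe hcard
  refine ⟨hfin.toFinset, isFreeFamily_coe_iff.1 ?_, ?_⟩
  · rw [hfin.coe_toFinset]
    exact ⟨hL'.trans hL.1, hL.2.mono hL'⟩
  · rw [hfin.encard_eq_coe_toFinset_card] at hcard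
    exact_mod_cast hcard

theorem SeparatedHoles.subset {F G : Finset (ℝ × ℝ)} (hF : SeparatedHoles Ω F) (h : G ⊆ F) :
    SeparatedHoles Ω G :=
  ⟨fun H hH => hF.1 H (h hH), fun H hH J hJ => hF.2 H (h hH) J (h hJ)⟩

theorem SeparatedHoles.union {F G : Finset (ℝ × ℝ)} (hF : SeparatedHoles Ω F)
    (hG : SeparatedHoles Ω G)
    (h : ∀ H ∈ F, ∀ J ∈ G, H.2 < J.1 ∨ J.2 < H.1) : SeparatedHoles Ω (F ∪ G) := by
  constructor
  · intro H hH
    rcases Finset.mem_union.1 hH with hH | hH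
    exacts [hF.1 H hH, hG.1 H hH]
  · intro H hH J hJ hne
    rcases Finset.mem_union.1 hH with hH | hH <;> rcases Finset.mem_union.1 hJ with hJ | hJ
    exacts [hF.2 H hH J hJ hne, h H hH J hJ, (h J hJ H hH).symm, hG.2 H hH J hJ hne]

theorem card_union_of_separated {F G : Finset (ℝ × ℝ)} (hF : ∀ H ∈ F, H ∈ holes Ω)
    (h : ∀ H ∈ F, ∀ J ∈ G, H.2 < J.1 ∨ J.2 < H.1) : (F ∪ G).card = F.card + G.card := by
  refine Finset.card_union_of_disjoint (Finset.disjoint_left.2 fun H h1 h2 => ?_)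
  have := (hF H h1).1
  rcases h H h1 H h2 with h | h <;> linarith

/-- Two holes sharing no endpoint have disjoint closures. -/
theorem holes_separated {H J : ℝ × ℝ} (hH : H ∈ holes Ω) (hJ : J ∈ holes Ω)
    (h1 : H.1 ≠ J.1) (h2 : H.2 ≠ J.1) (h3 : H.1 ≠ J.2) : H.2 < J.1 ∨ J.2 < H.1 := by
  rcases lt_or_gt_of_ne h1 with h | h
  · left
    refine lt_of_le_of_ne ?_ h2
    by_contra hc
    exact Set.disjoint_left.1 hH.2.2.2 ⟨h, not_le.1 hc⟩ hJ.2.1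
  · right
    refine lt_of_le_of_ne ?_ h3.symm
    by_contra hc
    exact Set.disjoint_left.1 hJ.2.2.2 ⟨h, not_le.1 hc⟩ hH.2.1

theorem holes_ext_left {H J : ℝ × ℝ} (hH : H ∈ holes Ω) (hJ : J ∈ holes Ω)
    (h : H.1 = J.1) : H = J := by
  refine Prod.ext h ?_
  have a := hH.1
  have b := hJ.1
  rcases lt_trichotomy H.2 J.2 with c | c | c
  · exact (Set.disjoint_left.1 hJ.2.2.2 ⟨by linarith, c⟩ hH.2.2.1).elim
  · exact c
  · exact (Set.disjoint_left.1 hH.2.2.2 ⟨by linarith, c⟩ hJ.2.2.1).elim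

theorem holes_ext_right {H J : ℝ × ℝ} (hH : H ∈ holes Ω) (hJ : J ∈ holes Ω)
    (h : H.2 = J.2) : H = J := by
  refine Prod.ext ?_ h
  have a := hH.1
  have b := hJ.1
  rcases lt_trichotomy H.1 J.1 with c | c | c
  · exact (Set.disjoint_left.1 hH.2.2.2 ⟨c, by linarith⟩ hJ.2.1).elim
  · exact c
  · exact (Set.disjoint_left.1 hJ.2.2.2 ⟨c, by linarith⟩ hH.2.1).elim

theorem holes_snd_le_of_fst_lt {H J : ℝ × ℝ} (hH : H ∈ holes Ω) (hJ : J ∈ holes Ω)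
    (h : H.1 < J.1) : H.2 ≤ J.1 := by
  by_contra hc
  exact Set.disjoint_left.1 hH.2.2.2 ⟨h, not_le.1 hc⟩ hJ.2.1

/-- Among finitely many holes, at least half form a free family. -/
theorem exists_separatedHoles_half (G : Finset (ℝ × ℝ)) (hG : ∀ H ∈ G, H ∈ holes Ω) :
    ∃ F ⊆ G, SeparatedHoles Ω F ∧ G.card ≤ 2 * F.card := by
  induction hk : G.card using Nat.strong_induction_on generalizing G with
  | _ k ih =>
  rcases G.eq_empty_or_nonempty with rfl | hne
  · exact ⟨∅, by simp, ⟨by simp, by simp⟩, by simpa using hk.symm.le⟩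
  obtain ⟨H, hH, hmax⟩ := G.exists_max_image Prod.fst hne
  have hc1 := Finset.card_erase_of_mem hH
  have hpos := hne.card_pos
  rcases (G.erase H).eq_empty_or_nonempty with h0 | hne1
  · refine ⟨{H}, by simpa using hH, ⟨by simpa using hG H hH, by simp⟩, ?_⟩
    rw [h0, Finset.card_empty] at hc1
    simp only [Finset.card_singleton]
    omega
  obtain ⟨J, hJ, hmaxJ⟩ := (G.erase H).exists_max_image Prod.fst hne1
  have hc2 := Finset.card_erase_of_mem hJ
  have hpos1 := hne1.card_pos
  have hlt : ∀ K ∈ G.erase H, K.1 < H.1 := by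
    intro K hK
    have hK' := Finset.mem_of_mem_erase hK
    refine lt_of_le_of_ne (hmax K hK') fun h => ?_
    exact (Finset.ne_of_mem_erase hK) (holes_ext_left (hG K hK') (hG H hH) h)
  have hJG := Finset.mem_of_mem_erase hJ
  obtain ⟨F, hFG, hF, hcard⟩ := ih ((G.erase H).erase J).card (by omega) ((G.erase H).erase J)
    (fun K hK => hG K (Finset.mem_of_mem_erase (Finset.mem_of_mem_erase hK))) rfl
  -- Only the neighbour `J` of the last hole `H` can share a point with it; holes left of `J` end at
  -- `J.1 < H.1` or earlier.
  have hsep : ∀ K ∈ ({H} : Finset (ℝ × ℝ)), ∀ L ∈ F, K.2 < L.1 ∨ L.2 < K.1 := by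
    intro K hK L hL
    rw [Finset.mem_singleton] at hK
    subst hK
    have hL1 := hFG hL
    have hL2 := Finset.mem_of_mem_erase hL1
    have hL3 := Finset.mem_of_mem_erase hL2
    have h1 : L.1 < J.1 := lt_of_le_of_ne (hmaxJ L hL2) fun h =>
      (Finset.ne_of_mem_erase hL1) (holes_ext_left (hG L hL3) (hG J hJG) h)
    have h2 := holes_snd_le_of_fst_lt (hG L hL3) (hG J hJG) h1
    have h3 := hlt J hJ
    right
    linarith
  have hHs : ∀ K ∈ ({H} : Finset (ℝ × ℝ)), K ∈ holes Ω := by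
    simpa using hG H hH
  refine ⟨{H} ∪ F, ?_, SeparatedHoles.union ⟨hHs, by simp⟩ hF hsep, ?_⟩
  · intro K hK
    rcases Finset.mem_union.1 hK with hK | hK
    · rw [Finset.mem_singleton] at hK
      exact hK ▸ hH
    · exact Finset.mem_of_mem_erase (Finset.mem_of_mem_erase (hFG hK))
  · rw [card_union_of_separated hHs hsep, Finset.card_singleton]
    omega

/-- A finite run of consecutive points of `Ω` is matched by a free family, up to one point. -/
theorem RelOrdConnected.exists_matching {T : Finset ℝ} (hT : RelOrdConnected Ω T)
    (hTΩ : ∀ t ∈ T, t ∈ Ω) :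
    ∃ F, SeparatedHoles Ω F ∧ (∀ H ∈ F, H.1 ∈ T ∧ H.2 ∈ T) ∧ T.card ≤ 2 * F.card + 1 := by
  rcases T.eq_empty_or_nonempty with rfl | hne
  · exact ⟨∅, ⟨by simp, by simp⟩, by simp, by simp⟩
  set M := T.max' hne
  have hM : M ∈ T := T.max'_mem hne
  have hnext : ∀ t ∈ T.erase M, ∃ u ∈ T, (t, u) ∈ holes Ω := by
    intro t ht
    have htT := Finset.mem_of_mem_erase ht
    have htM : t < M := lt_of_le_of_ne (T.le_max' t htT) (Finset.ne_of_mem_erase ht)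
    have hne' : (T.filter (fun u => t < u)).Nonempty := ⟨M, by simp [hM, htM]⟩
    have hu := Finset.min'_mem _ hne'
    set u := (T.filter (fun u => t < u)).min' hne'
    rw [Finset.mem_filter] at hu
    refine ⟨u, hu.1, hu.2, hTΩ t htT, hTΩ u hu.1, Set.disjoint_left.2 fun x hx hxΩ => ?_⟩
    have hxT := hT t htT u hu.1 x hxΩ hx.1.le hx.2.le
    have := Finset.min'_le (T.filter (fun u => t < u)) x (by simp [hxT, hx.1])
    exact absurd hx.2 (not_lt.2 this)
  choose! g hg1 hg2 using hnext
  have hinj : Set.InjOn (fun t => (t, g t)) (T.erase M : Set ℝ) :=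
    fun x _ y _ h => congrArg Prod.fst h
  obtain ⟨F, hFG, hF, hcard⟩ := exists_separatedHoles_half (Ω := Ω)
    ((T.erase M).image fun t => (t, g t)) (by
      intro H hH
      obtain ⟨t, ht, rfl⟩ := Finset.mem_image.1 hH
      exact hg2 t ht)
  rw [Finset.card_image_of_injOn hinj, Finset.card_erase_of_mem hM] at hcard
  refine ⟨F, hF, fun H hH => ?_, by omega⟩
  obtain ⟨t, ht, rfl⟩ := Finset.mem_image.1 (hFG hH)
  exact ⟨Finset.mem_of_mem_erase ht, hg1 t ht⟩

theorem SeparatedHoles.two_mul_card_le {F : Finset (ℝ × ℝ)} (hF : SeparatedHoles Ω F)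
    {B : Finset ℝ} (hB : ∀ H ∈ F, H.1 ∈ B ∧ H.2 ∈ B) : 2 * F.card ≤ B.card := by
  have h1 : (F.image Prod.fst).card = F.card := Finset.card_image_of_injOn
    fun H hH J hJ h => holes_ext_left (hF.1 H hH) (hF.1 J hJ) h
  have h2 : (F.image Prod.snd).card = F.card := Finset.card_image_of_injOn
    fun H hH J hJ h => holes_ext_right (hF.1 H hH) (hF.1 J hJ) h
  have h3 : Disjoint (F.image Prod.fst) (F.image Prod.snd) := by
    refine Finset.disjoint_left.2 fun x hx hy => ?_
    obtain ⟨H, hH, rfl⟩ := Finset.mem_image.1 hx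
    obtain ⟨J, hJ, hJH⟩ := Finset.mem_image.1 hy
    have a := (hF.1 H hH).1
    have b := (hF.1 J hJ).1
    rcases eq_or_ne H J with rfl | hne
    · linarith
    · rcases hF.2 H hH J hJ hne with h | h <;> linarith
  have h4 : F.image Prod.fst ∪ F.image Prod.snd ⊆ B := by
    intro x hx
    rcases Finset.mem_union.1 hx with hx | hx <;> obtain ⟨H, hH, rfl⟩ := Finset.mem_image.1 hx
    exacts [(hB H hH).1, (hB H hH).2]
  have := Finset.card_le_card h4
  rw [Finset.card_union_of_disjoint h3] at this
  omega

/-- At most one member of a free family touches a given point. -/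
theorem SeparatedHoles.exists_avoids {F : Finset (ℝ × ℝ)} (hF : SeparatedHoles Ω F) (x : ℝ) :
    ∃ G ⊆ F, AvoidsPoint G x ∧ F.card ≤ G.card + 1 := by
  classical
  by_cases h : AvoidsPoint F x
  · exact ⟨F, subset_rfl, h, by omega⟩
  unfold AvoidsPoint at h
  push Not at h
  obtain ⟨H, hH, hx⟩ := h
  refine ⟨F.erase H, Finset.erase_subset _ _, fun J hJ => ?_, ?_⟩
  · have hJF := Finset.mem_of_mem_erase hJ
    have a := (hF.1 H hH).1
    have b := (hF.1 J hJF).1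
    have c : x = H.1 ∨ x = H.2 := by
      by_cases e : H.1 = x
      exacts [Or.inl e.symm, Or.inr (hx e).symm]
    have d := hF.2 J hJF H hH (Finset.ne_of_mem_erase hJ)
    constructor <;> intro e <;> rcases c with c | c <;> rcases d with d | d <;> linarith
  · have := Finset.card_erase_of_mem hH
    have := Finset.card_pos.2 ⟨H, hH⟩
    omega

/-! ### Blocks of eccentric points -/

/-- `B` is a finite set of consecutive points of `Ω`, isolated from the other points of `Ω` as far
as holes are concerned, and `m` is an extremal point of `B`. -/
structure EndBlock (Ω : Set ℝ) (m : ℝ) (B : Finset ℝ) : Prop where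
  subset : ∀ x ∈ B, x ∈ Ω
  mem : m ∈ B
  hole_iff : ∀ H ∈ holes Ω, H.1 ∈ B ↔ H.2 ∈ B
  ordConnected : RelOrdConnected Ω B
  ordConnected_erase : RelOrdConnected Ω (B.erase m)

/-- No hole joins `B` to the rest of `Ω`, so the members `G` of `F` inside `B` can be exchanged for
a matching of `T` without disturbing the others. -/
theorem EndBlock.exists_replace {m : ℝ} {B T : Finset ℝ} (hB : EndBlock Ω m B) (hTB : T ⊆ B)
    (hT : RelOrdConnected Ω T) {F : Finset (ℝ × ℝ)} (hF : SeparatedHoles Ω F) :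
    ∃ F' G, SeparatedHoles Ω F' ∧ G ⊆ F ∧ (∀ H ∈ G, H.1 ∈ B ∧ H.2 ∈ B) ∧
      2 * F.card + T.card ≤ 2 * F'.card + 2 * G.card + 1 ∧
      ∀ H ∈ F', (H ∈ F ∧ H.1 ∉ B ∧ H.2 ∉ B) ∨ (H.1 ∈ T ∧ H.2 ∈ T) := by
  classical
  obtain ⟨P, hP, hPT, hPc⟩ := hT.exists_matching fun t ht => hB.subset t (hTB ht)
  have hsep : ∀ H ∈ P, ∀ J ∈ F.filter (fun H => H.1 ∉ B), H.2 < J.1 ∨ J.2 < H.1 := by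
    intro H hH J hJ
    rw [Finset.mem_filter] at hJ
    have h1 := hTB (hPT H hH).1
    have h2 := hTB (hPT H hH).2
    have h3 : J.2 ∉ B := fun h => hJ.2 ((hB.hole_iff J (hF.1 J hJ.1)).2 h)
    exact holes_separated (hP.1 H hH) (hF.1 J hJ.1) (fun h => hJ.2 (h ▸ h1))
      (fun h => hJ.2 (h ▸ h2)) (fun h => h3 (h ▸ h1))
  refine ⟨P ∪ F.filter (fun H => H.1 ∉ B), F.filter (fun H => H.1 ∈ B),
    hP.union (hF.subset (Finset.filter_subset _ _)) hsep, Finset.filter_subset _ _, ?_, ?_, ?_⟩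
  · intro H hH
    rw [Finset.mem_filter] at hH
    exact ⟨hH.2, (hB.hole_iff H (hF.1 H hH.1)).1 hH.2⟩
  · rw [card_union_of_separated hP.1 hsep]
    have := Finset.card_filter_add_card_filter_not (s := F) (fun H => H.1 ∈ B)
    omega
  · intro H hH
    rcases Finset.mem_union.1 hH with hH | hH
    · exact Or.inr (hPT H hH)
    · rw [Finset.mem_filter] at hH
      exact Or.inl ⟨hH.1, hH.2, fun h => hH.2 ((hB.hole_iff H (hF.1 H hH.1)).2 h)⟩

/-- Avoiding `m`, a free family has at most `|B| / 2 - 1` holes in the even block `B`, while a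
perfect matching has `|B| / 2`. -/
theorem EndBlock.exists_larger {m : ℝ} {B : Finset ℝ} (hB : EndBlock Ω m B) (hev : Even B.card)
    {F : Finset (ℝ × ℝ)} (hF : SeparatedHoles Ω F) (hm : AvoidsPoint F m) :
    ∃ F', SeparatedHoles Ω F' ∧ F.card + 1 ≤ F'.card ∧
      ∀ z, z ∉ B → AvoidsPoint F z → AvoidsPoint F' z := by
  obtain ⟨F', G, hF', hGF, hGB, hcard, hmem⟩ := hB.exists_replace subset_rfl hB.ordConnected hF
  have h1 := (hF.subset hGF).two_mul_card_le (B := B.erase m) fun H hH =>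
    ⟨Finset.mem_erase.2 ⟨(hm H (hGF hH)).1, (hGB H hH).1⟩,
      Finset.mem_erase.2 ⟨(hm H (hGF hH)).2, (hGB H hH).2⟩⟩
  rw [Finset.card_erase_of_mem hB.mem] at h1
  have h2 := Finset.card_pos.2 ⟨m, hB.mem⟩
  obtain ⟨k, hk⟩ := hev
  refine ⟨F', hF', by omega, fun z hz hFz H hH => ?_⟩
  rcases hmem H hH with h | h
  · exact hFz H h.1
  · exact ⟨fun e => hz (e ▸ h.1), fun e => hz (e ▸ h.2)⟩

/-- An odd block carries at most `(|B| - 1) / 2` free holes, and matching all points but `m` attains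
this. -/
theorem EndBlock.exists_avoiding {m : ℝ} {B : Finset ℝ} (hB : EndBlock Ω m B) (hodd : Odd B.card)
    {F : Finset (ℝ × ℝ)} (hF : SeparatedHoles Ω F) :
    ∃ F', SeparatedHoles Ω F' ∧ F.card ≤ F'.card ∧ AvoidsPoint F' m ∧
      ∀ z, z ∉ B → AvoidsPoint F z → AvoidsPoint F' z := by
  obtain ⟨F', G, hF', hGF, hGB, hcard, hmem⟩ :=
    hB.exists_replace (Finset.erase_subset m B) hB.ordConnected_erase hF
  have h1 := (hF.subset hGF).two_mul_card_le hGB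
  rw [Finset.card_erase_of_mem hB.mem] at hcard
  obtain ⟨k, hk⟩ := hodd
  refine ⟨F', hF', by omega, fun H hH => ?_, fun z hz hFz H hH => ?_⟩
  · rcases hmem H hH with h | h
    · exact ⟨fun e => h.2.1 (e ▸ hB.mem), fun e => h.2.2 (e ▸ hB.mem)⟩
    · exact ⟨Finset.ne_of_mem_erase h.1, Finset.ne_of_mem_erase h.2⟩
  · rcases hmem H hH with h | h
    · exact hFz H h.1
    · exact ⟨fun e => hz (e ▸ Finset.mem_of_mem_erase h.1),
        fun e => hz (e ▸ Finset.mem_of_mem_erase h.2)⟩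

theorem holes_finite_of_freeHoleNumber_eq {l : ℕ} (hl : freeHoleNumber Ω = l) :
    (holes Ω).Finite := by
  by_contra hinf
  obtain ⟨G, hG, hcard⟩ := Set.Infinite.exists_subset_card_eq hinf (2 * l + 2)
  obtain ⟨F, _, hF, hGF⟩ := exists_separatedHoles_half G fun H hH => hG hH
  have := hF.card_le_freeHoleNumber
  rw [hl] at this
  have : F.card ≤ l := by exact_mod_cast this
  omega

theorem exists_pos_of_not_mem_derivedSet {x : ℝ} (hx : x ∉ derivedSet Ω) :
    ∃ ε > 0, ∀ y ∈ Ω, |y - x| < ε → y = x := by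
  rw [mem_derivedSet, accPt_iff_nhds] at hx
  push Not at hx
  obtain ⟨U, hU, h⟩ := hx
  obtain ⟨ε, hε, hball⟩ := Metric.mem_nhds_iff.1 hU
  exact ⟨ε, hε, fun y hy hyx => h y ⟨hball (by simpa [Real.dist_eq] using hyx), hy⟩⟩

theorem exists_hole_right (hΩ : IsCompact Ω) {x y : ℝ} (hx : x ∈ Ω) (hxd : x ∉ derivedSet Ω)
    (hy : y ∈ Ω) (hxy : x < y) : ∃ z, (x, z) ∈ holes Ω := by
  obtain ⟨ε, hε, h⟩ := exists_pos_of_not_mem_derivedSet hxd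
  have hK : IsCompact (Ω ∩ Set.Ioi x) := by
    have : Ω ∩ Set.Ioi x = Ω ∩ Set.Ici (x + ε) := by
      ext z
      simp only [Set.mem_inter_iff, Set.mem_Ioi, Set.mem_Ici, and_congr_right_iff]
      refine fun hz => ⟨fun hxz => ?_, fun hxz => by linarith⟩
      by_contra hc
      exact hxz.ne' (h z hz (abs_lt.2 ⟨by linarith, by linarith⟩))
    rw [this]
    exact hΩ.inter_right isClosed_Ici
  have hne : (Ω ∩ Set.Ioi x).Nonempty := ⟨y, hy, hxy⟩
  obtain ⟨hz1, hz2⟩ := hK.sInf_mem hne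
  refine ⟨sInf (Ω ∩ Set.Ioi x), hz2, hx, hz1, Set.disjoint_left.2 fun w hw hwΩ => ?_⟩
  exact absurd (csInf_le hK.bddBelow ⟨hwΩ, hw.1⟩) (not_le.2 hw.2)

theorem exists_hole_left (hΩ : IsCompact Ω) {x y : ℝ} (hx : x ∈ Ω) (hxd : x ∉ derivedSet Ω)
    (hy : y ∈ Ω) (hxy : y < x) : ∃ z, (z, x) ∈ holes Ω := by
  obtain ⟨ε, hε, h⟩ := exists_pos_of_not_mem_derivedSet hxd
  have hK : IsCompact (Ω ∩ Set.Iio x) := by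
    have : Ω ∩ Set.Iio x = Ω ∩ Set.Iic (x - ε) := by
      ext z
      simp only [Set.mem_inter_iff, Set.mem_Iio, Set.mem_Iic, and_congr_right_iff]
      refine fun hz => ⟨fun hxz => ?_, fun hxz => by linarith⟩
      by_contra hc
      exact hxz.ne (h z hz (abs_lt.2 ⟨by linarith, by linarith⟩))
    rw [this]
    exact hΩ.inter_right isClosed_Iic
  have hne : (Ω ∩ Set.Iio x).Nonempty := ⟨y, hy, hxy⟩
  obtain ⟨hz1, hz2⟩ := hK.sSup_mem hne
  refine ⟨sSup (Ω ∩ Set.Iio x), hz2, hz1, hx, Set.disjoint_left.2 fun w hw hwΩ => ?_⟩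
  exact absurd (le_csSup hK.bddAbove ⟨hwΩ, hw.2⟩) (not_le.2 hw.1)

theorem isCompact_derivedSet (hΩ : IsCompact Ω) : IsCompact (derivedSet Ω) :=
  hΩ.of_isClosed_subset (isClosed_derivedSet Ω)
    ((isClosed_iff_derivedSet_subset Ω).1 hΩ.isClosed)

theorem derivedSet_nonempty (hΩ : IsCompact Ω) (hinf : Ω.Infinite) : (derivedSet Ω).Nonempty := by
  obtain ⟨x, _, hx⟩ := hinf.exists_accPt_of_subset_isCompact hΩ subset_rfl
  exact ⟨x, hx⟩

/-- The block consists of the left eccentric points and the smallest limit point `a`. Each eccentric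
point on the left is the left end of a hole, so there are finitely many. Because `a` is counted too,
the parity is that of `B.card - 1`. -/
theorem exists_left_endBlock (hΩ : IsCompact Ω) (hinf : Ω.Infinite) (hfin : (holes Ω).Finite) :
    ∃ B, EndBlock Ω (sInf Ω) B ∧ sSup Ω ∉ B ∧ leftParity Ω = (B.card - 1) % 2 := by
  have hdc := isCompact_derivedSet hΩ
  have hdn := derivedSet_nonempty hΩ hinf
  have hdΩ := (isClosed_iff_derivedSet_subset Ω).1 hΩ.isClosed
  set a := sInf (derivedSet Ω)
  have had : a ∈ derivedSet Ω := hdc.sInf_mem hdn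
  have ha : ∀ y ∈ derivedSet Ω, a ≤ y := fun y hy => csInf_le hdc.bddBelow hy
  have hmin : ∀ y ∈ Ω, sInf Ω ≤ y := fun y hy => csInf_le hΩ.bddBelow hy
  have hmax : ∀ y ∈ Ω, y ≤ sSup Ω := fun y hy => le_csSup hΩ.bddAbove hy
  have hminΩ : sInf Ω ∈ Ω := hΩ.sInf_mem hinf.nonempty
  have hhole : ∀ x ∈ {x ∈ Ω | x < a}, ∃ z, (x, z) ∈ holes Ω := fun x hx =>
    exists_hole_right hΩ hx.1 (fun h => absurd (ha x h) (not_le.2 hx.2)) (hdΩ had) hx.2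
  have hE : {x ∈ Ω | x < a}.Finite := by
    refine (hfin.image Prod.fst).subset fun x hx => ?_
    obtain ⟨z, hz⟩ := hhole x hx
    exact ⟨_, hz, rfl⟩
  set E := hE.toFinset with hE_def
  have hmemE : ∀ x, x ∈ E ↔ x ∈ Ω ∧ x < a := fun x => by simp [hE_def]
  have haE : a ∉ E := by simp [hmemE]
  have hmemB : ∀ x, x ∈ insert a E ↔ x ∈ Ω ∧ x ≤ a := fun x => by
    rw [Finset.mem_insert, hmemE, le_iff_eq_or_lt]
    constructor
    · rintro (rfl | h)
      exacts [⟨hdΩ had, Or.inl rfl⟩, ⟨h.1, Or.inr h.2⟩]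
    · rintro ⟨h1, h2 | h2⟩
      exacts [Or.inl h2, Or.inr ⟨h1, h2⟩]
  -- Only finitely many points of `Ω` lie left of the limit point `a`, so it is approached from the
  -- right and no hole starts there.
  have ha_hole : ∀ H ∈ holes Ω, H.1 ≠ a := by
    intro H hH hHa
    have hfr := accPt_iff_frequently.1 had
    have hev : ∀ᶠ y in nhds a, y ∉ E ∧ y < H.2 := by
      refine Filter.Eventually.and ?_ (gt_mem_nhds (hHa ▸ hH.1))
      exact E.finite_toSet.isClosed.isOpen_compl.mem_nhds haE
    obtain ⟨y, ⟨hy1, hy2⟩, hy3, hy4⟩ := (hfr.and_eventually hev).exists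
    have : a < y := by
      rcases lt_or_gt_of_ne hy1 with h | h
      · exact absurd ((hmemE y).2 ⟨hy2, h⟩) hy3
      · exact h
    exact Set.disjoint_left.1 hH.2.2.2 ⟨hHa ▸ this, hy4⟩ hy2
  refine ⟨insert a E, ⟨fun x hx => ((hmemB x).1 hx).1, (hmemB _).2 ⟨hminΩ, hmin a (hdΩ had)⟩,
    fun H hH => ?_, ?_, ?_⟩, ?_, ?_⟩
  · rw [hmemB, hmemB]
    constructor
    · rintro ⟨_, h⟩
      refine ⟨hH.2.2.1, ?_⟩
      by_contra hc
      exact Set.disjoint_left.1 hH.2.2.2 ⟨lt_of_le_of_ne h (ha_hole H hH), not_le.1 hc⟩ (hdΩ had)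
    · rintro ⟨_, h⟩
      exact ⟨hH.2.1, hH.1.le.trans h⟩
  · intro s _ t ht x hx _ hxt
    exact (hmemB x).2 ⟨hx, hxt.trans ((hmemB t).1 ht).2⟩
  · intro s hs t ht x hx hsx hxt
    refine Finset.mem_erase.2 ⟨fun h => ?_,
      (hmemB x).2 ⟨hx, hxt.trans ((hmemB t).1 (Finset.mem_of_mem_erase ht)).2⟩⟩
    exact Finset.ne_of_mem_erase hs (le_antisymm (h ▸ hsx)
      (hmin s ((hmemB s).1 (Finset.mem_of_mem_erase hs)).1))
  · rw [hmemB]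
    rintro ⟨_, h⟩
    refine hinf ((insert a E).finite_toSet.subset fun x hx => ?_)
    exact (hmemB x).2 ⟨hx, (hmax x hx).trans h⟩
  · have : {x ∈ eccentricPoints Ω | ∀ y ∈ derivedSet Ω, x < y} = (E : Set ℝ) := by
      ext x
      rw [Finset.mem_coe, hmemE]
      constructor
      · rintro ⟨h1, h2⟩
        exact ⟨h1.1, h2 a had⟩
      · rintro ⟨h1, h2⟩
        refine ⟨⟨h1, fun hc => ?_⟩, fun y hy => h2.trans_le (ha y hy)⟩
        exact absurd (convexHull_min (t := Set.Ici a) ha (convex_Ici a) hc) (not_le.2 h2)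
    rw [leftParity, this, Set.ncard_coe_finset, Finset.card_insert_of_notMem haE,
      Nat.add_sub_cancel]

theorem exists_right_endBlock (hΩ : IsCompact Ω) (hinf : Ω.Infinite) (hfin : (holes Ω).Finite) :
    ∃ B, EndBlock Ω (sSup Ω) B ∧ sInf Ω ∉ B ∧ rightParity Ω = (B.card - 1) % 2 := by
  have hdc := isCompact_derivedSet hΩ
  have hdn := derivedSet_nonempty hΩ hinf
  have hdΩ := (isClosed_iff_derivedSet_subset Ω).1 hΩ.isClosed
  set a := sSup (derivedSet Ω)
  have had : a ∈ derivedSet Ω := hdc.sSup_mem hdn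
  have ha : ∀ y ∈ derivedSet Ω, y ≤ a := fun y hy => le_csSup hdc.bddAbove hy
  have hmin : ∀ y ∈ Ω, sInf Ω ≤ y := fun y hy => csInf_le hΩ.bddBelow hy
  have hmax : ∀ y ∈ Ω, y ≤ sSup Ω := fun y hy => le_csSup hΩ.bddAbove hy
  have hmaxΩ : sSup Ω ∈ Ω := hΩ.sSup_mem hinf.nonempty
  have hhole : ∀ x ∈ {x ∈ Ω | a < x}, ∃ z, (z, x) ∈ holes Ω := fun x hx =>
    exists_hole_left hΩ hx.1 (fun h => absurd (ha x h) (not_le.2 hx.2)) (hdΩ had) hx.2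
  have hE : {x ∈ Ω | a < x}.Finite := by
    refine (hfin.image Prod.snd).subset fun x hx => ?_
    obtain ⟨z, hz⟩ := hhole x hx
    exact ⟨_, hz, rfl⟩
  set E := hE.toFinset with hE_def
  have hmemE : ∀ x, x ∈ E ↔ x ∈ Ω ∧ a < x := fun x => by simp [hE_def]
  have haE : a ∉ E := by simp [hmemE]
  have hmemB : ∀ x, x ∈ insert a E ↔ x ∈ Ω ∧ a ≤ x := fun x => by
    rw [Finset.mem_insert, hmemE, le_iff_eq_or_lt]
    constructor
    · rintro (rfl | h)
      exacts [⟨hdΩ had, Or.inl rfl⟩, ⟨h.1, Or.inr h.2⟩]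
    · rintro ⟨h1, h2 | h2⟩
      exacts [Or.inl h2.symm, Or.inr ⟨h1, h2⟩]
  have ha_hole : ∀ H ∈ holes Ω, H.2 ≠ a := by
    intro H hH hHa
    have hfr := accPt_iff_frequently.1 had
    have hev : ∀ᶠ y in nhds a, y ∉ E ∧ H.1 < y := by
      refine Filter.Eventually.and ?_ (lt_mem_nhds (hHa ▸ hH.1))
      exact E.finite_toSet.isClosed.isOpen_compl.mem_nhds haE
    obtain ⟨y, ⟨hy1, hy2⟩, hy3, hy4⟩ := (hfr.and_eventually hev).exists
    have : y < a := by
      rcases lt_or_gt_of_ne hy1 with h | h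
      · exact h
      · exact absurd ((hmemE y).2 ⟨hy2, h⟩) hy3
    exact Set.disjoint_left.1 hH.2.2.2 ⟨hy4, hHa ▸ this⟩ hy2
  refine ⟨insert a E, ⟨fun x hx => ((hmemB x).1 hx).1, (hmemB _).2 ⟨hmaxΩ, hmax a (hdΩ had)⟩,
    fun H hH => ?_, ?_, ?_⟩, ?_, ?_⟩
  · rw [hmemB, hmemB]
    constructor
    · rintro ⟨_, h⟩
      exact ⟨hH.2.2.1, h.trans hH.1.le⟩
    · rintro ⟨_, h⟩
      refine ⟨hH.2.1, ?_⟩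
      by_contra hc
      exact Set.disjoint_left.1 hH.2.2.2 ⟨not_le.1 hc, lt_of_le_of_ne h (ha_hole H hH).symm⟩
        (hdΩ had)
  · intro s hs t _ x hx hsx _
    exact (hmemB x).2 ⟨hx, ((hmemB s).1 hs).2.trans hsx⟩
  · intro s hs t ht x hx hsx hxt
    refine Finset.mem_erase.2 ⟨fun h => ?_,
      (hmemB x).2 ⟨hx, ((hmemB s).1 (Finset.mem_of_mem_erase hs)).2.trans hsx⟩⟩
    exact Finset.ne_of_mem_erase ht (le_antisymm
      (hmax t ((hmemB t).1 (Finset.mem_of_mem_erase ht)).1) (h ▸ hxt))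
  · rw [hmemB]
    rintro ⟨_, h⟩
    refine hinf ((insert a E).finite_toSet.subset fun x hx => ?_)
    exact (hmemB x).2 ⟨hx, h.trans (hmin x hx)⟩
  · have : {x ∈ eccentricPoints Ω | ∀ y ∈ derivedSet Ω, y < x} = (E : Set ℝ) := by
      ext x
      rw [Finset.mem_coe, hmemE]
      constructor
      · rintro ⟨h1, h2⟩
        exact ⟨h1.1, h2 a had⟩
      · rintro ⟨h1, h2⟩
        refine ⟨⟨h1, fun hc => ?_⟩, fun y hy => (ha y hy).trans_lt h2⟩
        exact absurd (convexHull_min (t := Set.Iic a) ha (convex_Iic a) hc) (not_le.2 h2)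
    rw [rightParity, this, Set.ncard_coe_finset, Finset.card_insert_of_notMem haE,
      Nat.add_sub_cancel]

/-! ### Configurations of holes and extremal points -/

/-- A free family of holes together with an optional use of the two extremal points of `Ω`, all
whose points lie in `S`. -/
structure HoleConfig (Ω S : Set ℝ) (F : Finset (ℝ × ℝ)) (sl sr : ℕ) : Prop where
  separated : SeparatedHoles Ω F
  mem : ∀ H ∈ F, H.1 ∈ S ∧ H.2 ∈ S
  left_le : sl ≤ 1
  right_le : sr ≤ 1
  left_mem : sl = 1 → sInf Ω ∈ S ∧ AvoidsPoint F (sInf Ω)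
  right_mem : sr = 1 → sSup Ω ∈ S ∧ AvoidsPoint F (sSup Ω)

theorem leftParity_le_one : leftParity Ω ≤ 1 := Nat.lt_succ_iff.1 (Nat.mod_lt _ two_pos)

theorem rightParity_le_one : rightParity Ω ≤ 1 := Nat.lt_succ_iff.1 (Nat.mod_lt _ two_pos)

theorem exists_left_larger (hΩ : IsCompact Ω) (hinf : Ω.Infinite) (hfin : (holes Ω).Finite)
    (hp : leftParity Ω = 1) {F : Finset (ℝ × ℝ)} (hF : SeparatedHoles Ω F)
    (hm : AvoidsPoint F (sInf Ω)) :
    ∃ F', SeparatedHoles Ω F' ∧ F.card + 1 ≤ F'.card ∧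
      (AvoidsPoint F (sSup Ω) → AvoidsPoint F' (sSup Ω)) := by
  obtain ⟨B, hB, hM, hpB⟩ := exists_left_endBlock hΩ hinf hfin
  have hpos := Finset.card_pos.2 ⟨_, hB.mem⟩
  have hev : Even B.card := by
    rw [Nat.even_iff]
    omega
  obtain ⟨F', hF', hc, hz⟩ := hB.exists_larger hev hF hm
  exact ⟨F', hF', hc, hz _ hM⟩

theorem exists_right_larger (hΩ : IsCompact Ω) (hinf : Ω.Infinite) (hfin : (holes Ω).Finite)
    (hp : rightParity Ω = 1) {F : Finset (ℝ × ℝ)} (hF : SeparatedHoles Ω F)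
    (hM : AvoidsPoint F (sSup Ω)) :
    ∃ F', SeparatedHoles Ω F' ∧ F.card + 1 ≤ F'.card ∧
      (AvoidsPoint F (sInf Ω) → AvoidsPoint F' (sInf Ω)) := by
  obtain ⟨B, hB, hm, hpB⟩ := exists_right_endBlock hΩ hinf hfin
  have hpos := Finset.card_pos.2 ⟨_, hB.mem⟩
  have hev : Even B.card := by
    rw [Nat.even_iff]
    omega
  obtain ⟨F', hF', hc, hz⟩ := hB.exists_larger hev hF hM
  exact ⟨F', hF', hc, hz _ hm⟩

/-- If the parity is odd, an extremal point in use is traded for one more hole; hence `s` and the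
parity together contribute at most `1` beyond the holes. -/
theorem exists_left_absorb (hΩ : IsCompact Ω) (hinf : Ω.Infinite) (hfin : (holes Ω).Finite)
    {F : Finset (ℝ × ℝ)} (hF : SeparatedHoles Ω F) {s : ℕ} (hs : s ≤ 1)
    (hm : s = 1 → AvoidsPoint F (sInf Ω)) :
    ∃ F', SeparatedHoles Ω F' ∧ 2 * F.card + s + leftParity Ω ≤ 2 * F'.card + 1 ∧
      (AvoidsPoint F (sSup Ω) → AvoidsPoint F' (sSup Ω)) := by
  have hle := leftParity_le_one (Ω := Ω)
  by_cases h : leftParity Ω = 1 ∧ s = 1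
  · obtain ⟨F', hF', hc, hz⟩ := exists_left_larger hΩ hinf hfin h.1 hF (hm h.2)
    exact ⟨F', hF', by omega, hz⟩
  · exact ⟨F, hF, by omega, id⟩

theorem exists_right_absorb (hΩ : IsCompact Ω) (hinf : Ω.Infinite) (hfin : (holes Ω).Finite)
    {F : Finset (ℝ × ℝ)} (hF : SeparatedHoles Ω F) {s : ℕ} (hs : s ≤ 1)
    (hM : s = 1 → AvoidsPoint F (sSup Ω)) :
    ∃ F', SeparatedHoles Ω F' ∧ 2 * F.card + s + rightParity Ω ≤ 2 * F'.card + 1 ∧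
      (AvoidsPoint F (sInf Ω) → AvoidsPoint F' (sInf Ω)) := by
  have hle := rightParity_le_one (Ω := Ω)
  by_cases h : rightParity Ω = 1 ∧ s = 1
  · obtain ⟨F', hF', hc, hz⟩ := exists_right_larger hΩ hinf hfin h.1 hF (hM h.2)
    exact ⟨F', hF', by omega, hz⟩
  · exact ⟨F, hF, by omega, id⟩

theorem SeparatedHoles.card_le {F : Finset (ℝ × ℝ)} (hF : SeparatedHoles Ω F) {l : ℕ}
    (hl : freeHoleNumber Ω = l) : F.card ≤ l := by
  have := hF.card_le_freeHoleNumber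
  rw [hl] at this
  exact_mod_cast this

/-- If there is a hole, there is a point such that the configurations missing it fall short of the
optimal size by two. -/
theorem exists_critical_point (hΩ : IsCompact Ω) (hinf : Ω.Infinite) {l : ℕ}
    (hl : freeHoleNumber Ω = l) (hl1 : 1 ≤ l) :
    ∃ x, ∀ S : Set ℝ, x ∉ S → ∀ F sl sr, HoleConfig Ω S F sl sr →
      2 * F.card + sl + sr + leftParity Ω + rightParity Ω ≤ 2 * l := by
  classical
  have hfin := holes_finite_of_freeHoleNumber_eq hl
  have hpl := leftParity_le_one (Ω := Ω)
  have hpr := rightParity_le_one (Ω := Ω)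
  by_cases h1 : leftParity Ω = 1
  -- Without `sInf Ω` one has `sl = 0`, and the odd parity lets `F` gain a hole.
  · refine ⟨sInf Ω, fun S hS F sl sr hF => ?_⟩
    have hsl : sl ≠ 1 := fun h => hS (hF.left_mem h).1
    have := hF.left_le
    obtain ⟨F', hF', hc, hz⟩ := exists_left_larger hΩ hinf hfin h1 hF.separated
      fun H hH => ⟨fun h => hS (h ▸ (hF.mem H hH).1), fun h => hS (h ▸ (hF.mem H hH).2)⟩
    obtain ⟨F'', hF'', hc', _⟩ := exists_right_absorb hΩ hinf hfin hF' hF.right_le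
      fun h => hz (hF.right_mem h).2
    have := hF''.card_le hl
    omega
  by_cases h2 : rightParity Ω = 1
  · refine ⟨sSup Ω, fun S hS F sl sr hF => ?_⟩
    have hsr : sr ≠ 1 := fun h => hS (hF.right_mem h).1
    have := hF.right_le
    obtain ⟨F', hF', hc, hz⟩ := exists_right_larger hΩ hinf hfin h2 hF.separated
      fun H hH => ⟨fun h => hS (h ▸ (hF.mem H hH).1), fun h => hS (h ▸ (hF.mem H hH).2)⟩
    obtain ⟨F'', hF'', hc', _⟩ := exists_left_absorb hΩ hinf hfin hF' hF.left_le
      fun h => hz (hF.left_mem h).2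
    have := hF''.card_le hl
    omega
  have hne : (holes Ω).Nonempty := by
    obtain ⟨F, hF, hc⟩ := exists_separatedHoles_of_le (Ω := Ω) (k := l) hl.ge
    obtain ⟨H, hH⟩ := Finset.card_pos.1 (show 0 < F.card by omega)
    exact ⟨H, hF.1 H hH⟩
  obtain ⟨H, hH, hHmin⟩ := Set.exists_min_image (holes Ω) Prod.fst hfin hne
  -- Both parities are even, so it is enough to save one hole. `H` is the leftmost hole; a family
  -- not touching `H.2` contains neither `H` nor a hole adjacent to it, so `H` can be added.
  refine ⟨H.2, fun S hS F sl sr hF => ?_⟩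
  have hsep : ∀ K ∈ ({H} : Finset (ℝ × ℝ)), ∀ J ∈ F, K.2 < J.1 ∨ J.2 < K.1 := by
    intro K hK J hJ
    rw [Finset.mem_singleton] at hK
    subst hK
    have hJh := hF.separated.1 J hJ
    have hJS := hF.mem J hJ
    have hlt := hJh.1
    have hmin := hHmin J hJh
    refine holes_separated hH hJh (fun h => ?_) (fun h => hS (h ▸ hJS.1)) (fun h => ?_)
    · exact hS (holes_ext_left hH hJh h ▸ hJS.2)
    · linarith
  have hs1 : ∀ K ∈ ({H} : Finset (ℝ × ℝ)), K ∈ holes Ω := by simpa using hH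
  have hfree : SeparatedHoles Ω ({H} ∪ F) := SeparatedHoles.union ⟨hs1, by simp⟩ hF.separated hsep
  have hc := hfree.card_le hl
  rw [card_union_of_separated hs1 hsep, Finset.card_singleton] at hc
  have := hF.left_le
  have := hF.right_le
  omega

/-- An optimal free family can be chosen to leave free those extremal points of `Ω` on whose side
the number of eccentric points is even. -/
theorem exists_optimal_separatedHoles (hΩ : IsCompact Ω) (hinf : Ω.Infinite) {l : ℕ}
    (hl : freeHoleNumber Ω = l) :
    ∃ F, SeparatedHoles Ω F ∧ F.card = l ∧ (leftParity Ω = 0 → AvoidsPoint F (sInf Ω)) ∧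
      (rightParity Ω = 0 → AvoidsPoint F (sSup Ω)) := by
  have hfin := holes_finite_of_freeHoleNumber_eq hl
  obtain ⟨F, hF, hc⟩ := exists_separatedHoles_of_le (Ω := Ω) (k := l) hl.ge
  obtain ⟨B, hB, hM, hpB⟩ := exists_left_endBlock hΩ hinf hfin
  obtain ⟨C, hC, hm, hpC⟩ := exists_right_endBlock hΩ hinf hfin
  have hposB := Finset.card_pos.2 ⟨_, hB.mem⟩
  have hposC := Finset.card_pos.2 ⟨_, hC.mem⟩
  obtain ⟨F', hF', hc', hF'm⟩ : ∃ F', SeparatedHoles Ω F' ∧ l ≤ F'.card ∧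
      (leftParity Ω = 0 → AvoidsPoint F' (sInf Ω)) := by
    by_cases h : leftParity Ω = 0
    · obtain ⟨F', h1, h2, h3, _⟩ := hB.exists_avoiding (by rw [Nat.odd_iff]; omega) hF
      exact ⟨F', h1, by omega, fun _ => h3⟩
    · exact ⟨F, hF, hc.ge, fun h' => absurd h' h⟩
  by_cases h : rightParity Ω = 0
  · obtain ⟨F'', h1, h2, h3, h4⟩ := hC.exists_avoiding (by rw [Nat.odd_iff]; omega) hF'
    exact ⟨F'', h1, le_antisymm (h1.card_le hl) (by omega), fun h => h4 _ hm (hF'm h), fun _ => h3⟩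
  · exact ⟨F', hF', le_antisymm (hF'.card_le hl) hc', hF'm, fun h' => absurd h' h⟩

/-! ### Upper bounds: systems of nodes -/

/-- A Lagrange-type family of polynomials nonnegative on `Ω` restricts to a positive basis. -/
theorem sup_natDegree_mem_positiveBasisMaxDegrees {n : ℕ} (x : Fin n → ℝ) (b : Fin n → ℝ[X])
    (hx : ∀ i, x i ∈ Ω) (hb : ∀ i, ∀ y ∈ Ω, 0 ≤ (b i).eval y) (hpos : ∀ i, 0 < (b i).eval (x i))
    (hzero : ∀ i j, i ≠ j → (b i).eval (x j) = 0) :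
    Finset.univ.sup (fun j => (b j).natDegree) ∈ positiveBasisMaxDegrees Ω n := by
  have heval : ∀ (c : Fin n → ℝ) (j : Fin n),
      (∑ i, c i • (b i).toContinuousMapOn Ω) ⟨x j, hx j⟩ = c j * (b j).eval (x j) := by
    intro c j
    rw [ContinuousMap.sum_apply, Finset.sum_eq_single j]
    · simp
    · intro i _ hij
      simp [hzero i j hij]
    · simp
  refine ⟨Submodule.span ℝ (Set.range fun j => (b j).toContinuousMapOn Ω), b,
    ⟨?_, rfl, ?_, ?_⟩, rfl⟩
  · rw [Fintype.linearIndependent_iff]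
    intro g hg j
    have h := heval g j
    rw [hg] at h
    simpa [(hpos j).ne'] using h.symm
  · intro j y
    simpa using hb j y y.2
  · intro f hf hf0
    obtain ⟨c, rfl⟩ := (Submodule.mem_span_range_iff_exists_fun ℝ).1 hf
    refine ⟨c, fun j => ?_, rfl⟩
    have h : 0 ≤ (∑ i, c i • (b i).toContinuousMapOn Ω) ⟨x j, hx j⟩ := hf0 ⟨x j, hx j⟩
    rw [heval c j] at h
    exact nonneg_of_mul_nonneg_left h (hpos j)

/-- A set `A` of nodes with a polynomial `w` of degree at most `d`, nonnegative on `Ω`, vanishing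
on `A` only, and with Lagrange-type polynomials for the nodes, of degree at most `d - e`. -/
structure NodeSystem (Ω : Set ℝ) (A : Finset ℝ) (d e : ℕ) : Prop where
  subset : ∀ x ∈ A, x ∈ Ω
  exists_poly : ∃ w : ℝ[X], w.natDegree ≤ d ∧ (∀ y ∈ Ω, 0 ≤ w.eval y) ∧
    (∀ y ∈ Ω, y ∉ A → 0 < w.eval y) ∧ (∀ y ∈ A, w.eval y = 0)
  exists_lagrange : ∀ x ∈ A, ∃ w : ℝ[X], w.natDegree + e ≤ d ∧ (∀ y ∈ Ω, 0 ≤ w.eval y) ∧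
    0 < w.eval x ∧ ∀ y ∈ A, y ≠ x → w.eval y = 0

theorem NodeSystem.empty {e : ℕ} : NodeSystem Ω ∅ 0 e :=
  ⟨by simp, ⟨1, by simp⟩, by simp⟩

/-- The Lagrange polynomial of one system is multiplied by the full vanishing polynomial of the
other; only one factor is shortened, so the saving `e` is kept but not doubled. -/
theorem NodeSystem.union_aux {A B : Finset ℝ} {d d' e : ℕ} (hA : NodeSystem Ω A d e)
    (hB : NodeSystem Ω B d' e) (hAB : Disjoint A B) : ∀ x ∈ A, ∃ w : ℝ[X],
      w.natDegree + e ≤ d + d' ∧ (∀ y ∈ Ω, 0 ≤ w.eval y) ∧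
      0 < w.eval x ∧ ∀ y, y ∈ A ∨ y ∈ B → y ≠ x → w.eval y = 0 := by
  intro x hx
  obtain ⟨w, hw1, hw2, hw3, hw4⟩ := hA.exists_lagrange x hx
  obtain ⟨v, hv1, hv2, hv3, hv4⟩ := hB.exists_poly
  refine ⟨w * v, ?_, fun y hy => ?_, ?_, fun y hy hyx => ?_⟩
  · have := natDegree_mul_le (p := w) (q := v)
    omega
  · rw [eval_mul]
    exact mul_nonneg (hw2 y hy) (hv2 y hy)
  · rw [eval_mul]
    exact mul_pos hw3 (hv3 x (hA.subset x hx) (Finset.disjoint_left.1 hAB hx))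
  · rw [eval_mul]
    rcases hy with hy | hy
    · rw [hw4 y hy hyx, zero_mul]
    · rw [hv4 y hy, mul_zero]

theorem NodeSystem.union {A B : Finset ℝ} {d d' e : ℕ} (hA : NodeSystem Ω A d e)
    (hB : NodeSystem Ω B d' e) (hAB : Disjoint A B) : NodeSystem Ω (A ∪ B) (d + d') e := by
  refine ⟨fun x hx => (Finset.mem_union.1 hx).elim (hA.subset x) (hB.subset x), ?_, ?_⟩
  · obtain ⟨w, hw1, hw2, hw3, hw4⟩ := hA.exists_poly
    obtain ⟨v, hv1, hv2, hv3, hv4⟩ := hB.exists_poly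
    refine ⟨w * v, natDegree_mul_le.trans (add_le_add hw1 hv1), fun y hy => ?_,
      fun y hy hyAB => ?_, fun y hy => ?_⟩
    · rw [eval_mul]
      exact mul_nonneg (hw2 y hy) (hv2 y hy)
    · rw [Finset.mem_union, not_or] at hyAB
      rw [eval_mul]
      exact mul_pos (hw3 y hy hyAB.1) (hv3 y hy hyAB.2)
    · rw [eval_mul]
      rcases Finset.mem_union.1 hy with hy | hy
      · rw [hw4 y hy, zero_mul]
      · rw [hv4 y hy, mul_zero]
  · intro x hx
    rcases Finset.mem_union.1 hx with hx | hx
    · obtain ⟨w, h1, h2, h3, h4⟩ := hA.union_aux hB hAB x hx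
      exact ⟨w, h1, h2, h3, fun y hy => h4 y (Finset.mem_union.1 hy)⟩
    · obtain ⟨w, h1, h2, h3, h4⟩ := hB.union_aux hA hAB.symm x hx
      exact ⟨w, by omega, h2, h3, fun y hy => h4 y (Finset.mem_union.1 hy).symm⟩

theorem NodeSystem.singleton_of {x : ℝ} {d e : ℕ} (hx : x ∈ Ω) (he : e ≤ d) (w : ℝ[X])
    (hd : w.natDegree ≤ d) (hw0 : w.eval x = 0) (hw : ∀ y ∈ Ω, y ≠ x → 0 < w.eval y) :
    NodeSystem Ω {x} d e := by
  refine ⟨by simpa using hx, ⟨w, hd, fun y hy => ?_, fun y hy h => hw y hy (by simpa using h), ?_⟩,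
    ?_⟩
  · rcases eq_or_ne y x with rfl | h
    exacts [hw0.ge, (hw y hy h).le]
  · simpa using hw0
  · intro y hy
    exact ⟨1, by simpa using he, by simp, by simp, fun z hz hzy =>
      absurd ((Finset.mem_singleton.1 hz).trans (Finset.mem_singleton.1 hy).symm) hzy⟩

theorem NodeSystem.left_end {e : ℕ} (hΩ : IsCompact Ω) (hne : Ω.Nonempty) (he : e ≤ 1) :
    NodeSystem Ω {sInf Ω} 1 e := by
  refine .singleton_of (hΩ.sInf_mem hne) he (X - C (sInf Ω)) (natDegree_X_sub_C_le _) (by simp)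
    fun y hy h => ?_
  simpa using lt_of_le_of_ne (csInf_le hΩ.bddBelow hy) h.symm

theorem NodeSystem.right_end {e : ℕ} (hΩ : IsCompact Ω) (hne : Ω.Nonempty) (he : e ≤ 1) :
    NodeSystem Ω {sSup Ω} 1 e := by
  refine .singleton_of (hΩ.sSup_mem hne) he (C (sSup Ω) - X) ?_ (by simp) fun y hy h => ?_
  · rw [← natDegree_neg, neg_sub]
    exact natDegree_X_sub_C_le _
  · simpa using lt_of_le_of_ne (le_csSup hΩ.bddAbove hy) h

theorem NodeSystem.square {e : ℕ} {x : ℝ} (hx : x ∈ Ω) (he : e ≤ 1) :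
    NodeSystem Ω {x} 2 e := by
  refine .singleton_of hx (by omega) ((X - C x) ^ 2) (by simp) (by simp) fun y hy h => ?_
  have := sub_ne_zero.2 h
  simp only [eval_pow, eval_sub, eval_X, eval_C]
  positivity

theorem NodeSystem.squares {e : ℕ} (A : Finset ℝ) (hA : ∀ x ∈ A, x ∈ Ω) (he : e ≤ 1) :
    NodeSystem Ω A (2 * A.card) e := by
  induction A using Finset.induction_on with
  | empty => exact .empty
  | insert x A hx ih =>
    rw [Finset.card_insert_of_notMem hx, Finset.insert_eq, mul_add, add_comm]
    exact (NodeSystem.square (hA x (Finset.mem_insert_self _ _)) he).union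
      (ih fun y hy => hA y (Finset.mem_insert_of_mem hy)) (Finset.disjoint_singleton_left.2 hx)

/-- The product `(X - α) * (X - β)` is negative only inside the hole. Isolating one end requires the
square of the other factor, which has the same degree, so nothing is saved and `e = 0`. -/
theorem NodeSystem.hole {H : ℝ × ℝ} (hH : H ∈ holes Ω) : NodeSystem Ω {H.1, H.2} 2 0 := by
  obtain ⟨hlt, h1, h2, hd⟩ := hH
  have hout : ∀ y ∈ Ω, y ≤ H.1 ∨ H.2 ≤ y := by
    intro y hy
    by_contra hc
    push Not at hc
    exact Set.disjoint_left.1 hd hc hy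
  refine ⟨?_, ⟨(X - C H.1) * (X - C H.2), ?_, fun y hy => ?_, fun y hy h => ?_, ?_⟩, ?_⟩
  · simp [h1, h2]
  · exact natDegree_mul_le.trans (add_le_add (natDegree_X_sub_C_le _) (natDegree_X_sub_C_le _))
  · simp only [eval_mul, eval_sub, eval_X, eval_C]
    rcases hout y hy with h | h
    · exact mul_nonneg_of_nonpos_of_nonpos (by linarith) (by linarith)
    · exact mul_nonneg (by linarith) (by linarith)
  · simp only [Finset.mem_insert, Finset.mem_singleton, not_or] at h
    simp only [eval_mul, eval_sub, eval_X, eval_C]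
    rcases hout y hy with h' | h'
    · have := lt_of_le_of_ne h' h.1
      exact mul_pos_of_neg_of_neg (by linarith) (by linarith)
    · have := lt_of_le_of_ne h' (Ne.symm h.2)
      exact mul_pos (by linarith) (by linarith)
  · simp
  · intro x hx
    simp only [Finset.mem_insert, Finset.mem_singleton] at hx ⊢
    rcases hx with rfl | rfl
    · refine ⟨(X - C H.2) ^ 2, by simp, fun y _ => ?_, ?_, ?_⟩
      · simp only [eval_pow]
        positivity
      · have := sub_ne_zero.2 hlt.ne
        simp only [eval_pow, eval_sub, eval_X, eval_C]
        positivity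
      · rintro y (rfl | rfl) h
        · exact absurd rfl h
        · simp
    · refine ⟨(X - C H.1) ^ 2, by simp, fun y _ => ?_, ?_, ?_⟩
      · simp only [eval_pow]
        positivity
      · have := sub_ne_zero.2 hlt.ne'
        simp only [eval_pow, eval_sub, eval_X, eval_C]
        positivity
      · rintro y (rfl | rfl) h
        · simp
        · exact absurd rfl h

/-- The endpoints of the members of `F`. -/
noncomputable def holeEndpoints (F : Finset (ℝ × ℝ)) : Finset ℝ :=
  F.image Prod.fst ∪ F.image Prod.snd

theorem mem_holeEndpoints {F : Finset (ℝ × ℝ)} {x : ℝ} :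
    x ∈ holeEndpoints F ↔ ∃ H ∈ F, H.1 = x ∨ H.2 = x := by
  simp only [holeEndpoints, Finset.mem_union, Finset.mem_image]
  constructor
  · rintro (⟨H, h, e⟩ | ⟨H, h, e⟩)
    exacts [⟨H, h, Or.inl e⟩, ⟨H, h, Or.inr e⟩]
  · rintro ⟨H, h, e | e⟩
    exacts [Or.inl ⟨H, h, e⟩, Or.inr ⟨H, h, e⟩]

theorem AvoidsPoint.notMem_holeEndpoints {F : Finset (ℝ × ℝ)} {x : ℝ} (h : AvoidsPoint F x) :
    x ∉ holeEndpoints F := by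
  rw [mem_holeEndpoints]
  rintro ⟨H, hH, e | e⟩
  exacts [(h H hH).1 e, (h H hH).2 e]

theorem SeparatedHoles.nodeSystem {F : Finset (ℝ × ℝ)} (hF : SeparatedHoles Ω F) :
    NodeSystem Ω (holeEndpoints F) (2 * F.card) 0 ∧ (holeEndpoints F).card = 2 * F.card := by
  induction F using Finset.induction_on with
  | empty => exact ⟨.empty, rfl⟩
  | insert H F hH ih =>
    obtain ⟨ih1, ih2⟩ := ih (hF.subset (Finset.subset_insert _ _))
    have hHh := hF.1 H (Finset.mem_insert_self _ _)
    have hdisj : Disjoint ({H.1, H.2} : Finset ℝ) (holeEndpoints F) := by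
      refine Finset.disjoint_left.2 fun x hx hxF => ?_
      obtain ⟨J, hJ, e⟩ := mem_holeEndpoints.1 hxF
      have hlt := hHh.1
      have hltJ := (hF.1 J (Finset.mem_insert_of_mem hJ)).1
      have hne : H ≠ J := fun h => hH (h ▸ hJ)
      simp only [Finset.mem_insert, Finset.mem_singleton] at hx
      rcases hF.2 H (Finset.mem_insert_self _ _) J (Finset.mem_insert_of_mem hJ) hne with h | h <;>
        rcases hx with hx | hx <;> rcases e with e | e <;> linarith
    have heq : holeEndpoints (insert H F) = {H.1, H.2} ∪ holeEndpoints F := by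
      ext x
      simp only [mem_holeEndpoints, Finset.mem_union, Finset.mem_insert, Finset.mem_singleton,
        exists_eq_or_imp, eq_comm (a := x)]
    rw [heq, Finset.card_insert_of_notMem hH, Finset.card_union_of_disjoint hdisj,
      Finset.card_pair hHh.1.ne, ih2, mul_add, mul_one, add_comm (2 * F.card)]
    exact ⟨(NodeSystem.hole hHh).union ih1 hdisj, rfl⟩

/-- Degrees realised by a system of nodes. -/
theorem NodeSystem.exists_mem_positiveBasisMaxDegrees {A : Finset ℝ} {d e n : ℕ}
    (hA : NodeSystem Ω A d e) (hn : A.card = n) (hn0 : 0 < n) :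
    ∃ k ∈ positiveBasisMaxDegrees Ω n, k + e ≤ d := by
  choose! b hb1 hb2 hb3 hb4 using hA.exists_lagrange
  let x : Fin n → ℝ := fun i => (A.equivFinOfCardEq hn).symm i
  have hx : ∀ i, x i ∈ A := fun i => ((A.equivFinOfCardEq hn).symm i).2
  have hinj : Function.Injective x := fun i j h =>
    (A.equivFinOfCardEq hn).symm.injective (Subtype.ext h)
  refine ⟨_, sup_natDegree_mem_positiveBasisMaxDegrees x (fun i => b (x i))
    (fun i => hA.subset _ (hx i)) (fun i => hb2 _ (hx i)) (fun i => hb3 _ (hx i))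
    (fun i j hij => hb4 _ (hx i) _ (hx j) fun h => hij (hinj h).symm), ?_⟩
  have hed : e ≤ d := (Nat.le_add_left _ _).trans (hb1 _ (hx ⟨0, hn0⟩))
  have : Finset.univ.sup (fun j => (b (x j)).natDegree) ≤ d - e :=
    Finset.sup_le fun i _ => Nat.le_sub_of_add_le (hb1 _ (hx i))
  omega

/-- Completing a system of nodes by double zeros. -/
theorem NodeSystem.exists_mem_of_card_le {A : Finset ℝ} {d e n t : ℕ} (hinf : Ω.Infinite)
    (hA : NodeSystem Ω A d e) (hn : A.card + t = n) (hn0 : 0 < n) (he : e ≤ 1) :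
    ∃ k ∈ positiveBasisMaxDegrees Ω n, k + e ≤ d + 2 * t := by
  obtain ⟨T, hT, hTc⟩ := (hinf.sdiff A.finite_toSet).exists_subset_card_eq t
  have hdisj : Disjoint A T := Finset.disjoint_left.2 fun x hx hxT => (hT hxT).2 hx
  have h := hA.union (NodeSystem.squares T (fun x hx => (hT hx).1) he) hdisj
  rw [hTc] at h
  exact h.exists_mem_positiveBasisMaxDegrees (by rw [Finset.card_union_of_disjoint hdisj]; omega) hn0

theorem SeparatedHoles.exists_nodeSystem_ends (hΩ : IsCompact Ω) (hinf : Ω.Infinite)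
    {F : Finset (ℝ × ℝ)} (hF : SeparatedHoles Ω F) {sl sr : ℕ} (hsl : sl ≤ 1) (hsr : sr ≤ 1)
    (hm : sl = 1 → AvoidsPoint F (sInf Ω)) (hM : sr = 1 → AvoidsPoint F (sSup Ω)) :
    ∃ A, NodeSystem Ω A (2 * F.card + sl + sr) 0 ∧ A.card = 2 * F.card + sl + sr := by
  have hne := hinf.nonempty
  have hmM : sInf Ω ≠ sSup Ω := by
    intro h
    refine hinf ((Set.finite_singleton (sInf Ω)).subset fun x hx => ?_)
    exact le_antisymm (h ▸ le_csSup hΩ.bddAbove hx) (csInf_le hΩ.bddBelow hx)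
  obtain ⟨hN, hc⟩ := hF.nodeSystem
  obtain ⟨A, hA, hAc, hAM⟩ : ∃ A, NodeSystem Ω A (2 * F.card + sl) 0 ∧
      A.card = 2 * F.card + sl ∧ (sSup Ω ∉ holeEndpoints F → sSup Ω ∉ A) := by
    rcases Nat.le_one_iff_eq_zero_or_eq_one.1 hsl with rfl | rfl
    · exact ⟨_, hN, hc, id⟩
    · have hd := Finset.disjoint_singleton_right.2 (hm rfl).notMem_holeEndpoints
      refine ⟨_, hN.union (NodeSystem.left_end hΩ hne zero_le_one) hd, ?_, fun h => ?_⟩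
      · rw [Finset.card_union_of_disjoint hd, hc, Finset.card_singleton]
      · rw [Finset.mem_union, Finset.mem_singleton]
        rintro (h' | h')
        exacts [h h', hmM h'.symm]
  rcases Nat.le_one_iff_eq_zero_or_eq_one.1 hsr with rfl | rfl
  · exact ⟨A, hA, hAc⟩
  · have hd := Finset.disjoint_singleton_right.2 (hAM (hM rfl).notMem_holeEndpoints)
    refine ⟨_, hA.union (NodeSystem.right_end hΩ hne zero_le_one) hd, ?_⟩
    rw [Finset.card_union_of_disjoint hd, hAc, Finset.card_singleton]

theorem exists_mem_le_of_lt_two_mul (hΩ : IsCompact Ω) (hinf : Ω.Infinite) {n : ℕ} (hn : 0 < n)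
    (h : (n : ℕ∞) ≤ 2 * freeHoleNumber Ω) :
    ∃ k ∈ positiveBasisMaxDegrees Ω n, k ≤ n := by
  -- `n - n / 2` is `n / 2` rounded up. For odd `n` the extra hole may be sacrificed to make `sInf
  -- Ω` available as a simple zero.
  have hk : ((n - n / 2 : ℕ) : ℕ∞) ≤ freeHoleNumber Ω := by
    generalize freeHoleNumber Ω = L at h
    induction L using ENat.recTopCoe with
    | top => exact le_top
    | coe L =>
      have : n ≤ 2 * L := by exact_mod_cast h
      have : n - n / 2 ≤ L := by omega
      exact_mod_cast this
  obtain ⟨F, hF, hc⟩ := exists_separatedHoles_of_le hk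
  rcases Nat.even_or_odd' n with ⟨q, hq | hq⟩
  · obtain ⟨hN, hNc⟩ := hF.nodeSystem
    obtain ⟨k, hk, hle⟩ := hN.exists_mem_of_card_le (n := n) (t := 0) hinf (by omega) hn zero_le_one
    exact ⟨k, hk, by omega⟩
  · obtain ⟨G, hGF, hG, hGc⟩ := hF.exists_avoids (sInf Ω)
    obtain ⟨G', hG', hG'c⟩ := Finset.exists_subset_card_eq (show q ≤ G.card by omega)
    obtain ⟨A, hA, hAc⟩ := (hF.subset (hG'.trans hGF)).exists_nodeSystem_ends hΩ hinf
      (le_refl 1) zero_le_one (fun _ H hH => hG H (hG' hH)) (by simp)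
    obtain ⟨k, hk, hle⟩ := hA.exists_mem_of_card_le (n := n) (t := 0) hinf (by omega) hn zero_le_one
    exact ⟨k, hk, by omega⟩

/-- The nodes are the ends of `l` holes, the extremal points on the sides of even parity, and double
zeros for the rest: the first two kinds cost one degree per node. -/
theorem exists_mem_le_of_eq (hΩ : IsCompact Ω) (hinf : Ω.Infinite) {n l : ℕ}
    (hl : freeHoleNumber Ω = l) (hn : 2 * l + 2 ≤ n) :
    ∃ k ∈ positiveBasisMaxDegrees Ω n,
      k ≤ 2 * (n - 1 - l) + leftParity Ω + rightParity Ω := by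
  obtain ⟨F, hF, hc, hm, hM⟩ := exists_optimal_separatedHoles hΩ hinf hl
  have hpl := leftParity_le_one (Ω := Ω)
  have hpr := rightParity_le_one (Ω := Ω)
  obtain ⟨A, hA, hAc⟩ := hF.exists_nodeSystem_ends hΩ hinf (Nat.sub_le 1 (leftParity Ω))
    (Nat.sub_le 1 (rightParity Ω)) (fun h => hm (by omega)) (fun h => hM (by omega))
  obtain ⟨k, hk, hle⟩ := hA.exists_mem_of_card_le (n := n) (t := n - A.card) hinf (by omega)
    (by omega) zero_le_one
  exact ⟨k, hk, by omega⟩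

/-- One node is missing after `l` holes. A free extremal point supplies it at cost `1`; if both
parities are odd, a double zero is used at cost `2`. -/
theorem exists_mem_le_of_odd (hΩ : IsCompact Ω) (hinf : Ω.Infinite) {n l : ℕ}
    (hl : freeHoleNumber Ω = l) (hn : n = 2 * l + 1) :
    ∃ k ∈ positiveBasisMaxDegrees Ω n, k ≤ n + leftParity Ω * rightParity Ω := by
  obtain ⟨F, hF, hc, hm, hM⟩ := exists_optimal_separatedHoles hΩ hinf hl
  have hpl := leftParity_le_one (Ω := Ω)
  have hpr := rightParity_le_one (Ω := Ω)
  by_cases h1 : leftParity Ω = 0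
  · obtain ⟨A, hA, hAc⟩ := hF.exists_nodeSystem_ends hΩ hinf le_rfl zero_le_one
      (fun _ => hm h1) (by simp)
    obtain ⟨k, hk, hle⟩ := hA.exists_mem_of_card_le (n := n) (t := 0) hinf (by omega)
      (by omega) zero_le_one
    exact ⟨k, hk, by omega⟩
  by_cases h2 : rightParity Ω = 0
  · obtain ⟨A, hA, hAc⟩ := hF.exists_nodeSystem_ends hΩ hinf zero_le_one le_rfl
      (by simp) (fun _ => hM h2)
    obtain ⟨k, hk, hle⟩ := hA.exists_mem_of_card_le (n := n) (t := 0) hinf (by omega)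
      (by omega) zero_le_one
    exact ⟨k, hk, by omega⟩
  obtain ⟨hN, hNc⟩ := hF.nodeSystem
  obtain ⟨k, hk, hle⟩ := hN.exists_mem_of_card_le (n := n) (t := 1) hinf (by omega) (by omega)
    zero_le_one
  have h1' : leftParity Ω = 1 := by omega
  have h2' : rightParity Ω = 1 := by omega
  exact ⟨k, hk, by rw [h1', h2']; omega⟩

/-- No hole is used, so every Lagrange polynomial drops at least one linear factor; hence `e = 1`
and `2 + 2 * (n - 2) - 1`. -/
theorem exists_mem_le_of_two_le (hΩ : IsCompact Ω) (hinf : Ω.Infinite) {n : ℕ} (hn : 2 ≤ n) :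
    ∃ k ∈ positiveBasisMaxDegrees Ω n, k ≤ 2 * n - 3 := by
  have hne := hinf.nonempty
  have hmM : sInf Ω ≠ sSup Ω := by
    intro h
    refine hinf ((Set.finite_singleton (sInf Ω)).subset fun x hx => ?_)
    exact le_antisymm (h ▸ le_csSup hΩ.bddAbove hx) (csInf_le hΩ.bddBelow hx)
  have hd : Disjoint ({sInf Ω} : Finset ℝ) {sSup Ω} := Finset.disjoint_singleton.2 hmM
  have hA := (NodeSystem.left_end hΩ hne (le_refl 1)).union (NodeSystem.right_end hΩ hne le_rfl) hd
  obtain ⟨k, hk, hle⟩ := hA.exists_mem_of_card_le (n := n) (t := n - 2) hinf (by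
    rw [Finset.card_union_of_disjoint hd, Finset.card_singleton, Finset.card_singleton]
    omega) (by omega) le_rfl
  exact ⟨k, hk, by omega⟩

/-! ### Zeros of polynomials nonnegative on `Ω` -/

/-- Each linear factor with its root in between flips the sign; once none is left, the intermediate
value theorem excludes a sign change. -/
theorem eval_mul_eval_pos_iff_even_countP_roots {y z : ℝ} (hyz : y < z) (p : ℝ[X]) (hp : p ≠ 0)
    (hy : p.eval y ≠ 0) (hz : p.eval z ≠ 0) :
    0 < p.eval y * p.eval z ↔ Even (p.roots.countP fun r => y < r ∧ r < z) := by
  induction hk : p.natDegree using Nat.strong_induction_on generalizing p with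
  | _ k ih =>
  by_cases hr : ∃ r, (y < r ∧ r < z) ∧ p.IsRoot r
  · obtain ⟨r, ⟨h1, h2⟩, hr⟩ := hr
    obtain ⟨q, rfl⟩ := dvd_iff_isRoot.2 hr
    have hq : q ≠ 0 := right_ne_zero_of_mul hp
    rw [natDegree_mul (X_sub_C_ne_zero r) hq, natDegree_X_sub_C] at hk
    simp only [eval_mul, eval_sub, eval_X, eval_C] at hy hz ⊢
    have ihq := ih q.natDegree (by omega) q hq (right_ne_zero_of_mul hy)
      (right_ne_zero_of_mul hz) rfl
    rw [roots_mul hp, roots_X_sub_C, Multiset.singleton_add, Multiset.countP_cons_of_pos _ ⟨h1, h2⟩,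
      Nat.even_add_one, ← ihq, not_lt]
    have hneg : (y - r) * (z - r) < 0 := mul_neg_of_neg_of_pos (by linarith) (by linarith)
    have hne : q.eval y * q.eval z ≠ 0 :=
      mul_ne_zero (right_ne_zero_of_mul hy) (right_ne_zero_of_mul hz)
    have : (y - r) * q.eval y * ((z - r) * q.eval z) =
        (y - r) * (z - r) * (q.eval y * q.eval z) := by ring
    rw [this]
    constructor
    · intro h
      exact (neg_of_mul_pos_right h hneg.le).le
    · intro h
      exact mul_pos_of_neg_of_neg hneg (lt_of_le_of_ne h hne)
  · have h0 : p.roots.countP (fun r => y < r ∧ r < z) = 0 := by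
      rw [Multiset.countP_eq_zero]
      exact fun r hr' hyr => hr ⟨r, hyr, isRoot_of_mem_roots hr'⟩
    rw [h0]
    refine iff_of_true ?_ (by simp)
    by_contra hc
    have hneg : p.eval y * p.eval z < 0 := lt_of_le_of_ne (not_lt.1 hc) (mul_ne_zero hy hz)
    have hmem : (0 : ℝ) ∈ Set.uIcc (p.eval y) (p.eval z) := by
      rw [Set.mem_uIcc]
      rcases mul_neg_iff.1 hneg with h | h
      exacts [Or.inr ⟨h.2.le, h.1.le⟩, Or.inl ⟨h.1.le, h.2.le⟩]
    obtain ⟨r, hr1, hr2⟩ := intermediate_value_uIcc p.continuous.continuousOn hmem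
    rw [Set.uIcc_of_le hyz.le] at hr1
    refine hr ⟨r, ⟨lt_of_le_of_ne hr1.1 ?_, lt_of_le_of_ne hr1.2 ?_⟩, hr2⟩
    · rintro rfl
      exact hy hr2
    · rintro rfl
      exact hz hr2

open Classical in
/-- The roots of `p` in `Ω`. -/
noncomputable def rootsIn (Ω : Set ℝ) (p : ℝ[X]) : Finset ℝ :=
  p.roots.toFinset.filter (· ∈ Ω)

theorem mem_rootsIn {p : ℝ[X]} (hp : p ≠ 0) {x : ℝ} :
    x ∈ rootsIn Ω p ↔ p.eval x = 0 ∧ x ∈ Ω := by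
  simp [rootsIn, hp]

theorem card_filter_rootsIn_le (p : ℝ[X]) (P : ℝ → Prop) [DecidablePred P] :
    ((rootsIn Ω p).filter P).card ≤ p.roots.countP P := by
  rw [Multiset.countP_eq_card_filter]
  refine le_trans (Finset.card_le_card (t := (p.roots.filter P).toFinset) fun x hx => ?_)
    (Multiset.toFinset_card_le _)
  simp only [rootsIn, Finset.mem_filter, Multiset.mem_toFinset] at hx
  simp only [Multiset.mem_toFinset, Multiset.mem_filter]
  exact ⟨hx.1.1, hx.2⟩

/-- The zeros are cut into runs of consecutive points of `Ω` separated by points where `p > 0`.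
Between two such points the number of roots with multiplicity is even, which pays for the point left
unmatched in an odd run. -/
theorem exists_right_config (hΩ : IsCompact Ω) {p : ℝ[X]} (hp : p ≠ 0)
    (hpΩ : ∀ x ∈ Ω, 0 ≤ p.eval x) {y : ℝ} (hy : y ∈ Ω) (hpy : p.eval y ≠ 0) :
    ∃ F sr, SeparatedHoles Ω F ∧
      (∀ H ∈ F, H.1 ∈ (rootsIn Ω p).filter (y < ·) ∧ H.2 ∈ (rootsIn Ω p).filter (y < ·)) ∧
      sr ≤ 1 ∧ (sr = 1 → sSup Ω ∈ (rootsIn Ω p).filter (y < ·) ∧ AvoidsPoint F (sSup Ω)) ∧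
      2 * ((rootsIn Ω p).filter (y < ·)).card ≤ p.roots.countP (y < ·) + 2 * F.card + sr := by
  induction hk : ((rootsIn Ω p).filter (y < ·)).card using Nat.strong_induction_on
    generalizing y with
  | _ k ih =>
  rcases ((rootsIn Ω p).filter (y < ·)).eq_empty_or_nonempty with h0 | hne
  · rw [h0, Finset.card_empty] at hk
    exact ⟨∅, 0, ⟨by simp, by simp⟩, by simp, by simp, by simp, by omega⟩
  obtain ⟨s, hsmem, hsmin⟩ : ∃ s ∈ (rootsIn Ω p).filter (y < ·),
      ∀ t ∈ (rootsIn Ω p).filter (y < ·), s ≤ t :=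
    ⟨_, Finset.min'_mem _ hne, fun t ht => Finset.min'_le _ t ht⟩
  rw [Finset.mem_filter, mem_rootsIn hp] at hsmem
  obtain ⟨⟨hps, hsΩ⟩, hys⟩ := hsmem
  by_cases hex : ∃ z, z ∈ Ω ∧ s < z ∧ p.eval z ≠ 0
  -- Minimality ends the first run: a point of `Ω` with `p ≠ 0` between two zeros of `T` would be a
  -- better choice than `z`.
  · obtain ⟨z, hz⟩ := exists_minimalFor_of_wellFoundedLT
      (fun z => z ∈ Ω ∧ s < z ∧ p.eval z ≠ 0)
      (fun z => ((rootsIn Ω p).filter fun r => y < r ∧ r < z).card) hex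
    obtain ⟨⟨hzΩ, hsz, hpz⟩, hzmin⟩ := hz
    have hyz := hys.trans hsz
    set T := (rootsIn Ω p).filter fun r => y < r ∧ r < z with hT_def
    have hmemT : ∀ x, x ∈ T ↔ (p.eval x = 0 ∧ x ∈ Ω) ∧ y < x ∧ x < z := fun x => by
      rw [hT_def, Finset.mem_filter, mem_rootsIn hp]
    have hT : RelOrdConnected Ω T := by
      intro u hu t ht x hx hux hxt
      by_contra hxT
      rw [hmemT] at hu ht hxT
      have hsu : s ≤ u := hsmin u (by
        rw [Finset.mem_filter, mem_rootsIn hp]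
        exact ⟨hu.1, hu.2.1⟩)
      have hpx : p.eval x ≠ 0 := fun h =>
        hxT ⟨⟨h, hx⟩, hu.2.1.trans_le hux, hxt.trans_lt ht.2.2⟩
      have hsx : s < x := lt_of_le_of_ne (hsu.trans hux) fun h => hpx (h ▸ hps)
      have hss : ((rootsIn Ω p).filter fun r => y < r ∧ r < x) ⊂ T := by
        rw [Finset.ssubset_iff_of_subset]
        · refine ⟨t, (hmemT t).2 ht, fun h => ?_⟩
          rw [Finset.mem_filter] at h
          linarith [h.2.2]
        · intro r hr
          rw [Finset.mem_filter, mem_rootsIn hp] at hr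
          exact (hmemT r).2 ⟨hr.1, hr.2.1, by linarith [hr.2.2, ht.2.2]⟩
      exact absurd (hzmin ⟨hx, hsx, hpx⟩ (Finset.card_lt_card hss).le)
        (not_le.2 (Finset.card_lt_card hss))
    obtain ⟨P, hP, hPT, hPc⟩ := hT.exists_matching fun t ht => ((hmemT t).1 ht).1.2
    have hsplit : ((rootsIn Ω p).filter (y < ·)).card =
        T.card + ((rootsIn Ω p).filter (z < ·)).card := by
      rw [hT_def, ← Finset.card_union_of_disjoint]
      · congr 1
        ext x
        simp only [Finset.mem_filter, Finset.mem_union, mem_rootsIn hp]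
        constructor
        · rintro ⟨h1, h2⟩
          rcases lt_trichotomy x z with h | h | h
          · exact Or.inl ⟨h1, h2, h⟩
          · exact absurd h1.1 (h ▸ hpz)
          · exact Or.inr ⟨h1, h⟩
        · rintro (⟨h1, h2, _⟩ | ⟨h1, h2⟩)
          exacts [⟨h1, h2⟩, ⟨h1, hyz.trans h2⟩]
      · refine Finset.disjoint_left.2 fun x hx hx' => ?_
        rw [Finset.mem_filter] at hx hx'
        linarith [hx.2.2, hx'.2]
    have hTpos : 0 < T.card := Finset.card_pos.2 ⟨s, (hmemT s).2 ⟨⟨hps, hsΩ⟩, hys, hsz⟩⟩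
    obtain ⟨F, sr, hF, hFm, hsr, hM, hFc⟩ := ih _ (by omega) hzΩ hpz rfl
    have hsep : ∀ H ∈ P, ∀ J ∈ F, H.2 < J.1 ∨ J.2 < H.1 := by
      intro H hH J hJ
      have h1 := ((hmemT _).1 (hPT H hH).2).2.2
      have h2 := (Finset.mem_filter.1 (hFm J hJ).1).2
      exact Or.inl (h1.trans h2)
    have hcount : p.roots.countP (fun r => y < r ∧ r < z) + p.roots.countP (z < ·) ≤
        p.roots.countP (y < ·) := by
      simp only [Multiset.countP_eq_card_filter]
      rw [← Multiset.card_add, Multiset.filter_add_filter]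
      have : p.roots.filter (fun r => (y < r ∧ r < z) ∧ z < r) = 0 := by
        rw [Multiset.filter_eq_nil]
        rintro r _ ⟨⟨_, h1⟩, h2⟩
        linarith
      rw [this, add_zero]
      refine Multiset.card_le_card (Multiset.monotone_filter_right _ fun r h => ?_)
      rcases h with h | h
      exacts [h.1, hyz.trans h]
    -- If `T.card` is odd, evenness gives at least `T.card + 1` roots, while `P` misses one point;
    -- either way `2 * T.card` is at most the root count plus `2 * P.card`.
    have heven := (eval_mul_eval_pos_iff_even_countP_roots hyz p hp hpy hpz).1
      (mul_pos (lt_of_le_of_ne (hpΩ y hy) hpy.symm) (lt_of_le_of_ne (hpΩ z hzΩ) hpz.symm))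
    have hTle : T.card ≤ p.roots.countP fun r => y < r ∧ r < z := card_filter_rootsIn_le p _
    obtain ⟨c, hc⟩ := heven
    refine ⟨P ∪ F, sr, hP.union hF hsep, ?_, hsr, fun h => ?_, ?_⟩
    · intro H hH
      simp only [Finset.mem_filter, mem_rootsIn hp] at hFm ⊢
      rcases Finset.mem_union.1 hH with hH | hH
      · have h1 := (hmemT _).1 (hPT H hH).1
        have h2 := (hmemT _).1 (hPT H hH).2
        exact ⟨⟨h1.1, h1.2.1⟩, h2.1, h2.2.1⟩
      · exact ⟨⟨(hFm H hH).1.1, hyz.trans (hFm H hH).1.2⟩, (hFm H hH).2.1,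
          hyz.trans (hFm H hH).2.2⟩
    · obtain ⟨h1, h2⟩ := hM h
      rw [Finset.mem_filter] at h1
      refine ⟨Finset.mem_filter.2 ⟨h1.1, hyz.trans h1.2⟩, fun H hH => ?_⟩
      rcases Finset.mem_union.1 hH with hH | hH
      · have h3 := ((hmemT _).1 (hPT H hH).1).2.2
        have h4 := ((hmemT _).1 (hPT H hH).2).2.2
        exact ⟨by linarith [h1.2], by linarith [h1.2]⟩
      · exact h2 H hH
    · rw [card_union_of_separated hP.1 hsep]
      omega
  -- All points of `Ω` from `s` on are zeros. No parity is available beyond the last run, and an odd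
  -- run is settled by using `sSup Ω`.
  · push Not at hex
    set T := (rootsIn Ω p).filter (y < ·) with hT_def
    have hmemT : ∀ x, x ∈ T ↔ x ∈ Ω ∧ s ≤ x := fun x => by
      constructor
      · intro hx
        refine ⟨?_, hsmin x hx⟩
        rw [hT_def, Finset.mem_filter, mem_rootsIn hp] at hx
        exact hx.1.2
      · rintro ⟨h1, h2⟩
        rw [hT_def, Finset.mem_filter, mem_rootsIn hp]
        refine ⟨⟨?_, h1⟩, hys.trans_le h2⟩
        rcases eq_or_lt_of_le h2 with rfl | h
        exacts [hps, hex x h1 h]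
    have hM : sSup Ω ∈ T := (hmemT _).2 ⟨hΩ.sSup_mem ⟨y, hy⟩, le_csSup hΩ.bddAbove hsΩ⟩
    have hTle : T.card ≤ p.roots.countP (y < ·) := card_filter_rootsIn_le p _
    rcases Nat.even_or_odd' T.card with ⟨q, hq | hq⟩
    · have hT : RelOrdConnected Ω T := fun u hu t _ x hx hux _ =>
        (hmemT x).2 ⟨hx, ((hmemT u).1 hu).2.trans hux⟩
      obtain ⟨P, hP, hPT, hPc⟩ := hT.exists_matching fun t ht => ((hmemT t).1 ht).1
      exact ⟨P, 0, hP, hPT, by simp, by simp, by omega⟩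
    · have hT : RelOrdConnected Ω (T.erase (sSup Ω)) := by
        intro u hu t ht x hx hux hxt
        rw [Finset.mem_erase, hmemT] at hu ht ⊢
        refine ⟨fun h => ht.1 (le_antisymm (le_csSup hΩ.bddAbove ht.2.1) (h ▸ hxt)),
          hx, hu.2.2.trans hux⟩
      obtain ⟨P, hP, hPT, hPc⟩ := hT.exists_matching fun t ht =>
        ((hmemT t).1 (Finset.mem_of_mem_erase ht)).1
      rw [Finset.card_erase_of_mem hM] at hPc
      refine ⟨P, 1, hP, fun H hH => ⟨Finset.mem_of_mem_erase (hPT H hH).1,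
        Finset.mem_of_mem_erase (hPT H hH).2⟩, le_rfl, fun _ => ⟨hM, fun H hH =>
        ⟨Finset.ne_of_mem_erase (hPT H hH).1, Finset.ne_of_mem_erase (hPT H hH).2⟩⟩, by omega⟩

theorem exists_holeConfig_rootsIn (hΩ : IsCompact Ω) (hinf : Ω.Infinite) {p : ℝ[X]} (hp : p ≠ 0)
    (hpΩ : ∀ x ∈ Ω, 0 ≤ p.eval x) :
    ∃ F sl sr, HoleConfig Ω (rootsIn Ω p) F sl sr ∧
      2 * (rootsIn Ω p).card ≤ p.natDegree + 2 * F.card + sl + sr := by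
  have hex : ∃ y, y ∈ Ω ∧ p.eval y ≠ 0 := by
    obtain ⟨y, hy, hy'⟩ := (hinf.sdiff (rootsIn Ω p).finite_toSet).nonempty
    exact ⟨y, hy, fun h => hy' (by simpa [mem_rootsIn hp] using ⟨h, hy⟩)⟩
  -- With the fewest zeros to the left of `y`, these zeros form an initial segment of `Ω`, treated
  -- as the final run was on the right.
  obtain ⟨y, ⟨hy, hpy⟩, hymin⟩ := exists_minimalFor_of_wellFoundedLT
    (fun y => y ∈ Ω ∧ p.eval y ≠ 0) (fun y => ((rootsIn Ω p).filter (· < y)).card) hex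
  set T := (rootsIn Ω p).filter (· < y) with hT_def
  have hmemT : ∀ x, x ∈ T ↔ (p.eval x = 0 ∧ x ∈ Ω) ∧ x < y := fun x => by
    rw [hT_def, Finset.mem_filter, mem_rootsIn hp]
  have hT : ∀ t ∈ T, ∀ x ∈ Ω, x ≤ t → x ∈ T := by
    intro t ht x hx hxt
    by_contra hxT
    rw [hmemT] at ht hxT
    have hpx : p.eval x ≠ 0 := fun h => hxT ⟨⟨h, hx⟩, hxt.trans_lt ht.2⟩
    have hss : ((rootsIn Ω p).filter (· < x)) ⊂ T := by
      rw [Finset.ssubset_iff_of_subset]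
      · refine ⟨t, (hmemT t).2 ht, fun h => ?_⟩
        rw [Finset.mem_filter] at h
        linarith [h.2]
      · intro r hr
        rw [Finset.mem_filter, mem_rootsIn hp] at hr
        exact (hmemT r).2 ⟨hr.1, by linarith [hr.2, ht.2]⟩
    exact absurd (hymin ⟨hx, hpx⟩ (Finset.card_lt_card hss).le)
      (not_le.2 (Finset.card_lt_card hss))
  have hmin : ∀ x ∈ Ω, sInf Ω ≤ x := fun x hx => csInf_le hΩ.bddBelow hx
  obtain ⟨P, sl, hP, hPT, hsl, hm, hPc⟩ : ∃ P sl, SeparatedHoles Ω P ∧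
      (∀ H ∈ P, H.1 ∈ T ∧ H.2 ∈ T) ∧ sl ≤ 1 ∧ (sl = 1 → sInf Ω ∈ T ∧ AvoidsPoint P (sInf Ω)) ∧
      T.card ≤ 2 * P.card + sl := by
    rcases Nat.even_or_odd' T.card with ⟨q, hq | hq⟩
    · obtain ⟨P, hP, hPT, hPc⟩ := RelOrdConnected.exists_matching (Ω := Ω) (T := T)
        (fun u _ t ht x hx _ hxt => hT t ht x hx hxt) fun t ht => ((hmemT t).1 ht).1.2
      exact ⟨P, 0, hP, hPT, by simp, by simp, by omega⟩
    · have hm : sInf Ω ∈ T := by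
        obtain ⟨t, ht⟩ := Finset.card_pos.1 (show 0 < T.card by omega)
        exact hT t ht _ (hΩ.sInf_mem hinf.nonempty) (hmin t ((hmemT t).1 ht).1.2)
      have hT' : RelOrdConnected Ω (T.erase (sInf Ω)) := by
        intro u hu t ht x hx hux hxt
        rw [Finset.mem_erase] at hu ht ⊢
        exact ⟨fun h => hu.1 (le_antisymm (h ▸ hux) (hmin u ((hmemT u).1 hu.2).1.2)),
          hT t ht.2 x hx hxt⟩
      obtain ⟨P, hP, hPT, hPc⟩ := hT'.exists_matching fun t ht =>
        ((hmemT t).1 (Finset.mem_of_mem_erase ht)).1.2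
      rw [Finset.card_erase_of_mem hm] at hPc
      refine ⟨P, 1, hP, fun H hH => ⟨Finset.mem_of_mem_erase (hPT H hH).1,
        Finset.mem_of_mem_erase (hPT H hH).2⟩, le_rfl, fun _ => ⟨hm, fun H hH =>
        ⟨Finset.ne_of_mem_erase (hPT H hH).1, Finset.ne_of_mem_erase (hPT H hH).2⟩⟩, by omega⟩
  obtain ⟨F, sr, hF, hFm, hsr, hM, hFc⟩ := exists_right_config hΩ hp hpΩ hy hpy
  have hPy : ∀ H ∈ P, H.1 < y ∧ H.2 < y := fun H hH =>
    ⟨((hmemT _).1 (hPT H hH).1).2, ((hmemT _).1 (hPT H hH).2).2⟩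
  have hFy : ∀ H ∈ F, y < H.1 ∧ y < H.2 := fun H hH =>
    ⟨(Finset.mem_filter.1 (hFm H hH).1).2, (Finset.mem_filter.1 (hFm H hH).2).2⟩
  have hsep : ∀ H ∈ P, ∀ J ∈ F, H.2 < J.1 ∨ J.2 < H.1 := fun H hH J hJ =>
    Or.inl ((hPy H hH).2.trans (hFy J hJ).1)
  have hTsub : ∀ x ∈ T, x ∈ rootsIn Ω p := fun x hx => (Finset.mem_filter.1 hx).1
  have hsplit : (rootsIn Ω p).card = T.card + ((rootsIn Ω p).filter (y < ·)).card := by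
    rw [hT_def, ← Finset.card_union_of_disjoint]
    · congr 1
      ext x
      simp only [Finset.mem_filter, Finset.mem_union, mem_rootsIn hp]
      constructor
      · intro h1
        rcases lt_trichotomy x y with h | h | h
        · exact Or.inl ⟨h1, h⟩
        · exact absurd h1.1 (h ▸ hpy)
        · exact Or.inr ⟨h1, h⟩
      · rintro (h | h)
        exacts [h.1, h.1]
    · refine Finset.disjoint_left.2 fun x hx hx' => ?_
      rw [Finset.mem_filter] at hx hx'
      linarith [hx.2, hx'.2]
  have hcount : p.roots.countP (· < y) + p.roots.countP (y < ·) ≤ p.natDegree := by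
    refine le_trans ?_ (card_roots' p)
    simp only [Multiset.countP_eq_card_filter]
    rw [← Multiset.card_add, Multiset.filter_add_filter]
    have : p.roots.filter (fun r => r < y ∧ y < r) = 0 := by
      rw [Multiset.filter_eq_nil]
      rintro r _ ⟨h1, h2⟩
      linarith
    rw [this, add_zero]
    exact Multiset.card_le_card (Multiset.filter_le _ _)
  have hTle : T.card ≤ p.roots.countP (· < y) := card_filter_rootsIn_le p _
  refine ⟨P ∪ F, sl, sr, ⟨hP.union hF hsep, ?_, hsl, hsr, fun h => ?_, fun h => ?_⟩, ?_⟩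
  · intro H hH
    rcases Finset.mem_union.1 hH with hH | hH
    · exact ⟨hTsub _ (hPT H hH).1, hTsub _ (hPT H hH).2⟩
    · exact ⟨(Finset.mem_filter.1 (hFm H hH).1).1, (Finset.mem_filter.1 (hFm H hH).2).1⟩
  · refine ⟨hTsub _ (hm h).1, fun H hH => ?_⟩
    have hmy := ((hmemT _).1 (hm h).1).2
    rcases Finset.mem_union.1 hH with hH | hH
    · exact (hm h).2 H hH
    · exact ⟨by linarith [(hFy H hH).1], by linarith [(hFy H hH).2]⟩
  · have hMy := Finset.mem_filter.1 (hM h).1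
    refine ⟨hMy.1, fun H hH => ?_⟩
    rcases Finset.mem_union.1 hH with hH | hH
    · exact ⟨by linarith [(hPy H hH).1, hMy.2], by linarith [(hPy H hH).2, hMy.2]⟩
    · exact (hM h).2 H hH
  · rw [card_union_of_separated hP.1 hsep]
    omega

/-- Either a single hole of `F` touches `t`, and then `t` is not an extremal point in use, or no
hole does, and only `sl` and `sr` can be lost. -/
theorem HoleConfig.exists_erase {S : Set ℝ} {F : Finset (ℝ × ℝ)} {sl sr : ℕ}
    (h : HoleConfig Ω S F sl sr) (t : ℝ) :
    ∃ F' sl' sr', HoleConfig Ω (S \ {t}) F' sl' sr' ∧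
      2 * F.card + sl + sr ≤ 2 * F'.card + sl' + sr' + 2 := by
  have hl := h.left_le
  have hr := h.right_le
  by_cases ht : AvoidsPoint F t
  · refine ⟨F, if sInf Ω = t then 0 else sl, if sSup Ω = t then 0 else sr,
      ⟨h.separated, fun H hH => ⟨⟨(h.mem H hH).1, (ht H hH).1⟩, (h.mem H hH).2, (ht H hH).2⟩,
        ?_, ?_, ?_, ?_⟩, ?_⟩
    · split_ifs <;> omega
    · split_ifs <;> omega
    · split_ifs with e
      · simp
      · exact fun hs => ⟨⟨(h.left_mem hs).1, e⟩, (h.left_mem hs).2⟩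
    · split_ifs with e
      · simp
      · exact fun hs => ⟨⟨(h.right_mem hs).1, e⟩, (h.right_mem hs).2⟩
    · split_ifs <;> omega
  · obtain ⟨G, hGF, hG, hc⟩ := h.separated.exists_avoids t
    have hne : ∀ x, AvoidsPoint F x → x ≠ t := fun x hx e => ht (e ▸ hx)
    refine ⟨G, sl, sr, ⟨h.separated.subset hGF, fun H hH => ⟨⟨(h.mem H (hGF hH)).1, (hG H hH).1⟩,
      (h.mem H (hGF hH)).2, (hG H hH).2⟩, hl, hr, fun hs => ?_, fun hs => ?_⟩, by omega⟩
    · exact ⟨⟨(h.left_mem hs).1, hne _ (h.left_mem hs).2⟩, fun H hH => (h.left_mem hs).2 H (hGF hH)⟩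
    · exact ⟨⟨(h.right_mem hs).1, hne _ (h.right_mem hs).2⟩,
        fun H hH => (h.right_mem hs).2 H (hGF hH)⟩

theorem HoleConfig.exists_sdiff {S : Set ℝ} {F : Finset (ℝ × ℝ)} {sl sr : ℕ}
    (h : HoleConfig Ω S F sl sr) (D : Finset ℝ) :
    ∃ F' sl' sr', HoleConfig Ω (S \ D) F' sl' sr' ∧
      2 * F.card + sl + sr ≤ 2 * F'.card + sl' + sr' + 2 * D.card := by
  induction D using Finset.induction_on with
  | empty => exact ⟨F, sl, sr, by simpa using h, by simp⟩
  | insert t D ht ih =>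
    obtain ⟨F', sl', sr', h', hle⟩ := ih
    obtain ⟨F'', sl'', sr'', h'', hle'⟩ := h'.exists_erase t
    refine ⟨F'', sl'', sr'', ?_, ?_⟩
    · rwa [Finset.coe_insert, Set.insert_eq, Set.union_comm, ← Set.sdiff_sdiff]
    · rw [Finset.card_insert_of_notMem ht]
      omega

/-- A polynomial nonnegative on `Ω` and vanishing on `S ⊆ Ω` has at least `2 |S|` zeros, up to the
savings made possible by the holes and the extremal points of `Ω`. -/
theorem exists_holeConfig (hΩ : IsCompact Ω) (hinf : Ω.Infinite) {p : ℝ[X]} (hp : p ≠ 0)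
    (hpΩ : ∀ x ∈ Ω, 0 ≤ p.eval x) (S : Finset ℝ) (hS : ∀ x ∈ S, x ∈ Ω ∧ p.eval x = 0) :
    ∃ F sl sr, HoleConfig Ω (S : Set ℝ) F sl sr ∧
      2 * S.card ≤ p.natDegree + 2 * F.card + sl + sr := by
  obtain ⟨F, sl, sr, h, hle⟩ := exists_holeConfig_rootsIn hΩ hinf hp hpΩ
  have hsub : S ⊆ rootsIn Ω p := fun x hx => (mem_rootsIn hp).2 ⟨(hS x hx).2, (hS x hx).1⟩
  obtain ⟨F', sl', sr', h', hle'⟩ := h.exists_sdiff (rootsIn Ω p \ S)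
  rw [← Finset.coe_sdiff, Finset.sdiff_sdiff_eq_self hsub] at h'
  have := Finset.card_sdiff_add_card_eq_card hsub
  exact ⟨F', sl', sr', h', by omega⟩

/-! ### Nodes of a positive basis -/

/-- Near a point at which `q` vanishes to at most the order of `p`, `p` is dominated by `q`. -/
theorem exists_eventually_abs_eval_le {p q : ℝ[X]} (hq : q ≠ 0) {x : ℝ}
    (h : q.rootMultiplicity x ≤ p.rootMultiplicity x) :
    ∃ C : ℝ, 0 ≤ C ∧ ∀ᶠ y in nhds x, |p.eval y| ≤ C * |q.eval y| := by
  obtain ⟨u, hu⟩ := (pow_dvd_pow (X - C x) h).trans (pow_rootMultiplicity_dvd p x)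
  set v := q /ₘ (X - C x) ^ q.rootMultiplicity x
  have hqv : (X - C x) ^ q.rootMultiplicity x * v = q := pow_mul_divByMonic_rootMultiplicity_eq q x
  have hv : v.eval x ≠ 0 := eval_divByMonic_pow_rootMultiplicity_ne_zero x hq
  have hvpos := abs_pos.2 hv
  have h1 : ∀ᶠ y in nhds x, |u.eval y| < |u.eval x| + 1 :=
    (u.continuous.abs.continuousAt).eventually_lt_const (lt_add_one _)
  have h2 : ∀ᶠ y in nhds x, |v.eval x| / 2 < |v.eval y| :=
    (v.continuous.abs.continuousAt).eventually_const_lt (half_lt_self hvpos)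
  refine ⟨(|u.eval x| + 1) / (|v.eval x| / 2), by positivity, ?_⟩
  filter_upwards [h1, h2] with y hy1 hy2
  have hy3 : |u.eval y| ≤ (|u.eval x| + 1) / (|v.eval x| / 2) * |v.eval y| := by
    rw [div_mul_eq_mul_div, le_div_iff₀ (half_pos hvpos)]
    exact mul_le_mul hy1.le hy2.le (half_pos hvpos).le (by positivity)
  calc |p.eval y| = |(y - x) ^ q.rootMultiplicity x| * |u.eval y| := by
        rw [hu, eval_mul, abs_mul]
        simp
    _ ≤ |(y - x) ^ q.rootMultiplicity x| *
        ((|u.eval x| + 1) / (|v.eval x| / 2) * |v.eval y|) := by gcongr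
    _ = (|u.eval x| + 1) / (|v.eval x| / 2) * |q.eval y| := by
        have hqy : q.eval y = (y - x) ^ q.rootMultiplicity x * v.eval y := by
          conv_lhs => rw [← hqv]
          simp
        rw [hqy, abs_mul]
        ring

/-- Each member of a positive basis of polynomials has a node in `Ω`: a point at which its order
of vanishing is smaller than that of all other members. -/
theorem IsPositiveBasis.exists_node {n : ℕ} (hΩ : IsCompact Ω) {X : Submodule ℝ C(Ω, ℝ)}
    {b : Fin n → ℝ[X]} (hb : IsPositiveBasis X fun j => (b j).toContinuousMapOn Ω) (j : Fin n) :
    ∃ x ∈ Ω, ∀ i, i ≠ j → (b j).rootMultiplicity x < (b i).rootMultiplicity x := by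
  by_contra! hc
  have hnn : ∀ i, ∀ y ∈ Ω, 0 ≤ (b i).eval y := fun i y hy => hb.nonneg i ⟨y, hy⟩
  have hne : ∀ i, b i ≠ 0 := by
    intro i h
    refine hb.linearIndependent.ne_zero i ?_
    ext y
    simp [h]
  -- The doubled `y ∈ Ω` matches the predicate of the compactness induction, whose sets need not lie
  -- inside `Ω`.
  have key : ∃ C : ℝ, 0 ≤ C ∧ ∀ y ∈ Ω, y ∈ Ω →
      (b j).eval y ≤ C * ∑ i ∈ Finset.univ.erase j, (b i).eval y := by
    refine hΩ.induction_on (p := fun s => ∃ C : ℝ, 0 ≤ C ∧ ∀ y ∈ s, y ∈ Ω →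
      (b j).eval y ≤ C * ∑ i ∈ Finset.univ.erase j, (b i).eval y) ⟨0, le_rfl, by simp⟩ ?_ ?_ ?_
    · rintro s t hst ⟨C, hC, h⟩
      exact ⟨C, hC, fun y hy => h y (hst hy)⟩
    · rintro s t ⟨C, hC, h⟩ ⟨D, hD, h'⟩
      refine ⟨C + D, add_nonneg hC hD, fun y hy hyΩ => ?_⟩
      have hs : 0 ≤ ∑ i ∈ Finset.univ.erase j, (b i).eval y :=
        Finset.sum_nonneg fun i _ => hnn i y hyΩ
      rw [add_mul]
      rcases hy with hy | hy
      · exact (h y hy hyΩ).trans (le_add_of_nonneg_right (mul_nonneg hD hs))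
      · exact (h' y hy hyΩ).trans (le_add_of_nonneg_left (mul_nonneg hC hs))
    · intro x hx
      obtain ⟨i, hij, hle⟩ := hc x hx
      obtain ⟨C, hC, hev⟩ := exists_eventually_abs_eval_le (hne i) hle
      refine ⟨_, mem_nhdsWithin_of_mem_nhds hev, C, hC, fun y hy hyΩ => ?_⟩
      have hy' : |(b j).eval y| ≤ C * |(b i).eval y| := hy
      rw [abs_of_nonneg (hnn j y hyΩ), abs_of_nonneg (hnn i y hyΩ)] at hy'
      refine hy'.trans (mul_le_mul_of_nonneg_left ?_ hC)
      exact Finset.single_le_sum (f := fun i => (b i).eval y) (fun i _ => hnn i y hyΩ)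
        (Finset.mem_erase.2 ⟨hij, Finset.mem_univ i⟩)
  obtain ⟨D, hD, h⟩ := key
  let d : Fin n → ℝ := fun i => if i = j then -1 else D
  have hd : ∀ y, ∑ i, d i * (b i).eval y =
      D * (∑ i ∈ Finset.univ.erase j, (b i).eval y) - (b j).eval y := by
    intro y
    rw [← Finset.add_sum_erase _ _ (Finset.mem_univ j), Finset.mul_sum]
    have : ∑ i ∈ Finset.univ.erase j, d i * (b i).eval y =
        ∑ i ∈ Finset.univ.erase j, D * (b i).eval y :=
      Finset.sum_congr rfl fun i hi => by simp [d, Finset.ne_of_mem_erase hi]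
    rw [this]
    simp [d]
    ring
  have hfX : ∑ i, d i • (b i).toContinuousMapOn Ω ∈ X := by
    rw [← hb.span_eq]
    exact Submodule.sum_mem _ fun i _ =>
      Submodule.smul_mem _ _ (Submodule.subset_span ⟨i, rfl⟩)
  have hf0 : 0 ≤ ∑ i, d i • (b i).toContinuousMapOn Ω := by
    intro y
    have : (∑ i, d i • (b i).toContinuousMapOn Ω) y = ∑ i, d i * (b i).eval (y : ℝ) := by
      rw [ContinuousMap.sum_apply]
      simp
    change 0 ≤ (∑ i, d i • (b i).toContinuousMapOn Ω) y
    rw [this, hd, sub_nonneg]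
    exact h y y.2 y.2
  obtain ⟨c, hc0, hfc⟩ := hb.nonneg_coeff _ hfX hf0
  -- Uniqueness of coefficients forces `c j = d j = -1`.
  have hli := Fintype.linearIndependent_iff.1 hb.linearIndependent (fun i => d i - c i) (by
    simp only [sub_smul, Finset.sum_sub_distrib]
    rw [sub_eq_zero]
    exact hfc) j
  have hdj : d j = -1 := by simp [d]
  have := hc0 j
  linarith

/-! ### Lower bounds -/

section LowerBound

variable {n : ℕ} {b : Fin n → ℝ[X]} {x : Fin n → ℝ}

theorem node_injective
    (hx : ∀ j i, i ≠ j → (b j).rootMultiplicity (x j) < (b i).rootMultiplicity (x j)) :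
    Function.Injective x := by
  intro i j hij
  by_contra h
  have h1 := hx j i h
  have h2 := hx i j (Ne.symm h)
  rw [hij] at h2
  omega

theorem eval_node_eq_zero
    (hx : ∀ j i, i ≠ j → (b j).rootMultiplicity (x j) < (b i).rootMultiplicity (x j))
    (hb : ∀ i, b i ≠ 0) {i j : Fin n} (hij : i ≠ j) : (b i).eval (x j) = 0 :=
  (rootMultiplicity_pos (hb i)).1 (lt_of_le_of_lt (Nat.zero_le _) (hx j i hij))

/-- If all degrees were below `n`, every polynomial of degree below `n` would equal its interpolant
in the `b i`. A parabola nonnegative at the nodes but negative at some point of `Ω` contradicts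
this. -/
theorem le_sup_natDegree (hn : 3 ≤ n) (hinf : Ω.Infinite) (hxΩ : ∀ j, x j ∈ Ω)
    (hx : ∀ j i, i ≠ j → (b j).rootMultiplicity (x j) < (b i).rootMultiplicity (x j))
    (hb : ∀ i, b i ≠ 0) (hpos : ∀ i, ∀ y ∈ Ω, 0 ≤ (b i).eval y) :
    n ≤ Finset.univ.sup (fun j => (b j).natDegree) := by
  by_contra hlt
  have hdeg : ∀ i, (b i).natDegree < n := fun i =>
    lt_of_le_of_lt (Finset.le_sup (f := fun j => (b j).natDegree) (Finset.mem_univ i))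
      (not_le.1 hlt)
  have hinj := node_injective hx
  have hne : ∀ i, (b i).eval (x i) ≠ 0 := by
    intro i hi
    refine hb i (eq_zero_of_natDegree_lt_card_of_eval_eq_zero _ hinj (fun j => ?_)
      (by simpa using hdeg i))
    rcases eq_or_ne i j with rfl | hij
    exacts [hi, eval_node_eq_zero hx hb hij]
  obtain ⟨y, hy, hyx⟩ := (hinf.sdiff (Set.finite_range x)).nonempty
  have hyx' : ∀ i, x i - y ≠ 0 := fun i h => hyx ⟨i, sub_eq_zero.1 h⟩
  -- `x k` is a node nearest to `y`, so the parabola centred at `y` and vanishing at `x k` is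
  -- nonnegative at all nodes.
  obtain ⟨k, _, hk⟩ := Finset.exists_min_image Finset.univ (fun i => (x i - y) ^ 2)
    ⟨(⟨0, by omega⟩ : Fin n), Finset.mem_univ _⟩
  set f : ℝ[X] := (X - C y) ^ 2 - C ((x k - y) ^ 2) with hf_def
  have hf : ∀ z, f.eval z = (z - y) ^ 2 - (x k - y) ^ 2 := fun z => by simp [hf_def]
  set g : ℝ[X] := ∑ i, C (f.eval (x i) / (b i).eval (x i)) * b i with hg_def
  have hgdeg : g.natDegree < n := by
    refine lt_of_le_of_lt (natDegree_sum_le_of_forall_le (n := n - 1) _ _ fun i _ => ?_) (by omega)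
    exact (natDegree_C_mul_le _ _).trans (by have := hdeg i; omega)
  -- The parabola has degree `2`; this is where `3 ≤ n` is needed.
  have hfdeg : f.natDegree < n := by
    rw [hf_def, natDegree_sub_C]
    simp
    omega
  have hfg : f - g = 0 := by
    refine eq_zero_of_natDegree_lt_card_of_eval_eq_zero _ hinj (fun j => ?_) ?_
    · rw [eval_sub, hg_def, eval_finsetSum, Finset.sum_eq_single j, eval_mul, eval_C,
        div_mul_cancel₀ _ (hne j), sub_self]
      · intro i _ hij
        rw [eval_mul, eval_node_eq_zero hx hb hij, mul_zero]
      · simp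
    · rw [Fintype.card_fin]
      exact lt_of_le_of_lt (natDegree_sub_le _ _) (max_lt hfdeg hgdeg)
  have h1 : f.eval y < 0 := by
    rw [hf]
    have : 0 < (x k - y) ^ 2 := by
      have := hyx' k
      positivity
    simpa using this
  have h2 : 0 ≤ g.eval y := by
    rw [hg_def, eval_finsetSum]
    refine Finset.sum_nonneg fun i _ => ?_
    rw [eval_mul, eval_C, hf]
    refine mul_nonneg (div_nonneg ?_ (hpos i _ (hxΩ i))) (hpos i y hy)
    have := hk i (Finset.mem_univ i)
    linarith
  rw [sub_eq_zero.1 hfg] at h1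
  linarith

/-- If `z` is a node, the member `b i` belonging to it is taken, since only the other nodes are
prescribed zeros of `b i`; otherwise any member will do. -/
theorem exists_holeConfig_of_nodes (hΩ : IsCompact Ω) (hinf : Ω.Infinite) (hn : 1 ≤ n)
    (hxΩ : ∀ j, x j ∈ Ω)
    (hx : ∀ j i, i ≠ j → (b j).rootMultiplicity (x j) < (b i).rootMultiplicity (x j))
    (hb : ∀ i, b i ≠ 0) (hpos : ∀ i, ∀ y ∈ Ω, 0 ≤ (b i).eval y) (z : ℝ) :
    ∃ (S : Set ℝ) (F : Finset (ℝ × ℝ)) (sl sr : ℕ), z ∉ S ∧ HoleConfig Ω S F sl sr ∧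
      2 * (n - 1) ≤ Finset.univ.sup (fun j => (b j).natDegree) + 2 * F.card + sl + sr := by
  have hinj := node_injective hx
  obtain ⟨i, hi⟩ : ∃ i, z ∉ (Finset.univ.erase i).image x := by
    by_cases hz : ∃ i, x i = z
    · obtain ⟨i, rfl⟩ := hz
      refine ⟨i, fun h => ?_⟩
      obtain ⟨j, hj, e⟩ := Finset.mem_image.1 h
      exact Finset.ne_of_mem_erase hj (hinj e)
    · refine ⟨⟨0, hn⟩, fun h => ?_⟩
      obtain ⟨j, _, e⟩ := Finset.mem_image.1 h
      exact hz ⟨j, e⟩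
  obtain ⟨F, sl, sr, hF, hle⟩ := exists_holeConfig hΩ hinf (hb i) (hpos i)
    ((Finset.univ.erase i).image x) (by
      intro y hy
      obtain ⟨j, hj, rfl⟩ := Finset.mem_image.1 hy
      exact ⟨hxΩ j, eval_node_eq_zero hx hb (Finset.ne_of_mem_erase hj).symm⟩)
  rw [Finset.card_image_of_injective _ hinj, Finset.card_erase_of_mem (Finset.mem_univ i),
    Finset.card_univ, Fintype.card_fin] at hle
  have := Finset.le_sup (f := fun j => (b j).natDegree) (Finset.mem_univ i)
  exact ⟨_, F, sl, sr, by exact_mod_cast hi, hF, by omega⟩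

end LowerBound

/-- The lower bounds for the degrees in a positive basis. -/
theorem le_of_mem_positiveBasisMaxDegrees {n : ℕ} (hn : 3 ≤ n) (hΩ : IsCompact Ω)
    (hinf : Ω.Infinite) {k : ℕ} (hk : k ∈ positiveBasisMaxDegrees Ω n) :
    n ≤ k ∧ (freeHoleNumber Ω = 0 → 2 * n - 3 ≤ k) ∧
      ∀ l : ℕ, freeHoleNumber Ω = l → 1 ≤ l → l < n →
        2 * (n - 1 - l) + leftParity Ω + rightParity Ω ≤ k := by
  obtain ⟨X, b, hb, rfl⟩ := hk
  have hpos : ∀ i, ∀ y ∈ Ω, 0 ≤ (b i).eval y := fun i y hy => hb.nonneg i ⟨y, hy⟩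
  have hne : ∀ i, b i ≠ 0 := by
    intro i h
    refine hb.linearIndependent.ne_zero i ?_
    ext y
    simp [h]
  choose x hxΩ hx using fun j => hb.exists_node hΩ j
  refine ⟨le_sup_natDegree hn hinf hxΩ hx hne hpos, fun h0 => ?_, fun l hl hl1 hln => ?_⟩
  · obtain ⟨S, F, sl, sr, hS, hF, hle⟩ :=
      exists_holeConfig_of_nodes hΩ hinf (by omega) hxΩ hx hne hpos (sInf Ω)
    have h1 : F.card ≤ 0 := hF.separated.card_le (by simpa using h0)
    have h2 : sl ≠ 1 := fun h => hS (hF.left_mem h).1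
    have := hF.left_le
    have := hF.right_le
    omega
  · obtain ⟨z, hz⟩ := exists_critical_point hΩ hinf hl hl1
    obtain ⟨S, F, sl, sr, hS, hF, hle⟩ :=
      exists_holeConfig_of_nodes hΩ hinf (by omega) hxΩ hx hne hpos z
    have := hz S hS F sl sr hF
    omega

/-! ### Conclusion -/

theorem isLeast_of_exists_le {s : Set ℕ} {d : ℕ} (h : ∃ k ∈ s, k ≤ d) (h' : ∀ k ∈ s, d ≤ k) :
    IsLeast s d := by
  obtain ⟨k, hk, hkd⟩ := h
  exact ⟨le_antisymm hkd (h' k hk) ▸ hk, h'⟩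

theorem mainTheorem2 (n : ℕ) (hn : 3 ≤ n) (Ω : Set ℝ) (hΩ : IsCompact Ω) (hinf : Ω.Infinite) :
    ((n : ℕ∞) < 2 * freeHoleNumber Ω → IsLeast (positiveBasisMaxDegrees Ω n) n) ∧
    (freeHoleNumber Ω = ((n / 2 : ℕ) : ℕ∞) → Even n →
      IsLeast (positiveBasisMaxDegrees Ω n) n) ∧
    (freeHoleNumber Ω = ((n / 2 : ℕ) : ℕ∞) → Odd n →
      IsLeast (positiveBasisMaxDegrees Ω n) (n + leftParity Ω * rightParity Ω)) ∧
    (∀ l : ℕ, freeHoleNumber Ω = (l : ℕ∞) → 1 ≤ l → (l : ℝ) ≤ (n : ℝ) / 2 - 1 →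
      IsLeast (positiveBasisMaxDegrees Ω n)
        (2 * (n - 1 - l) + leftParity Ω + rightParity Ω)) ∧
    (freeHoleNumber Ω = 0 → IsLeast (positiveBasisMaxDegrees Ω n) (2 * n - 3)) := by
  have hlow := fun k (hk : k ∈ positiveBasisMaxDegrees Ω n) =>
    le_of_mem_positiveBasisMaxDegrees hn hΩ hinf hk
  refine ⟨fun h => ?_, fun h he => ?_, fun h ho => ?_, fun l hl hl1 hln => ?_, fun h => ?_⟩
  · exact isLeast_of_exists_le (exists_mem_le_of_lt_two_mul hΩ hinf (by omega) h.le)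
      fun k hk => (hlow k hk).1
  · refine isLeast_of_exists_le (exists_mem_le_of_lt_two_mul hΩ hinf (by omega) ?_)
      fun k hk => (hlow k hk).1
    rw [h]
    have := Nat.two_mul_div_two_of_even he
    exact_mod_cast this.ge
  · have h2 := Nat.two_mul_div_two_add_one_of_odd ho
    refine isLeast_of_exists_le (exists_mem_le_of_odd hΩ hinf h h2.symm) fun k hk => ?_
    obtain ⟨h3, _, h4⟩ := hlow k hk
    -- With `n = 2 * l + 1` this bound is `n - 1` plus the two parities; it exceeds `n` only when
    -- both are `1`.
    have h5 := h4 _ h (by omega) (by omega)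
    have hpl := leftParity_le_one (Ω := Ω)
    have hpr := rightParity_le_one (Ω := Ω)
    by_cases hp : leftParity Ω = 0
    · rw [hp, zero_mul]
      exact h3
    by_cases hq : rightParity Ω = 0
    · rw [hq, mul_zero]
      exact h3
    have hp' : leftParity Ω = 1 := by omega
    have hq' : rightParity Ω = 1 := by omega
    rw [hp', hq'] at h5 ⊢
    omega
  · have hln' : 2 * l + 2 ≤ n := by
      have : (2 * l + 2 : ℝ) ≤ n := by linarith
      exact_mod_cast this
    exact isLeast_of_exists_le (exists_mem_le_of_eq hΩ hinf hl hln')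
      fun k hk => (hlow k hk).2.2 l hl hl1 (by omega)
  · exact isLeast_of_exists_le (exists_mem_le_of_two_le hΩ hinf (by omega))
      fun k hk => (hlow k hk).2.1 h
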